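/- Let $k$ be an algebraically closed field of characteristic $0$, let $\Gamma$ be a finite abelian group with character group $\hat\Gamma=\mathrm{Hom}(\Gamma,k^\times)$, and let $V$ be a Yetter–Drinfeld module over $k[\Gamma]$, i.e. a representation of $\Gamma$ together with a $\Gamma$-grading preserved by the action. For $g\in\Gamma$, $\chi\in\hat\Gamma$ write $V^\chi_g$ for the space of $v\in V$ that are homogeneous of degree $g$ (coaction $\delta(v)=g\otimes v$) and satisfy $h\cdot v=\chi(h)v$ for all $h\in\Gamma$. Suppose that $V$ has a finite basis $v_1,\dots,v_t$ with $v_i\in V^{\chi_i}_{g_i}$, where $g_i\in\Gamma$ and $\chi_i\in\hat\Gamma$, and that the Nichols algebra $\mathcal B(V)$ is finite-dimensional. (Here $\mathcal B(V)=T(V)/J$ with the structure of a bialgebra in Yetter–Drinfeld modules induced from the tensor algebra $T(V)$, in which the elements of $V$ are primitive; $J$ is the sum of all two-sided ideals of $T(V)$ that are Yetter–Drinfeld submodules and coideals and are generated by homogeneous elements of degree at least $2$.) Then there is a Yetter–Drinfeld module $W$ over $k[\hat\Gamma]$ with a basis $w_1,\dots,w_t$ such that $w_i\in W^{g_i}_{\chi_i}$,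 i.e. $\delta(w_i)=\chi_i\otimes w_i$ and $\gamma\cdot w_i=\gamma(g_i)w_i$ for all $\gamma\in\hat\Gamma$; and for every such $W$ there is an isomorphism of Hopf algebras $$(\mathcal B(V)\# k[\Gamma])^*\;\cong\;\mathcal B(W)\# k[\hat\Gamma],$$ where $\#$ denotes the Radford biproduct (bosonization) and the dual carries the convolution product $(f*f')(x)=f(x_{(1)})f'(x_{(2)})$ and the coproduct transpose to the multiplication, $\Delta f(x\otimes y)=f(xy)$. -/

import Mathlib

open scoped TensorProduct
universe u v w x

noncomputable section

/-- A Yetter-Drinfeld module over the group algebra `k[Γ]` of a finite abelian group `Γ`: a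
representation of `Γ` on `V` together with a `Γ`-grading `V = ⨁ g, V_g` preserved by the action.
The grading is given by its family of homogeneous projections `proj g : V → V_g`, that is, by a
complete family of orthogonal idempotents; the corresponding coaction is
`δ v = ∑ g, g ⊗ proj g v`, so that `V_g = {v | proj g v = v} = {v | δ v = g ⊗ v}`. -/
class YetterDrinfeld (k Γ V : Type*) [Field k] [CommGroup Γ] [Fintype Γ]
    [AddCommGroup V] [Module k V] where
  /-- the action of `Γ` -/
  act (k) : Γ →* Module.End k V
  /-- the projection onto the homogeneous component of degree `g` -/
  proj (k) : Γ → V →ₗ[k] V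
  proj_proj_of_ne : ∀ g h v, g ≠ h → proj g (proj h v) = 0
  sum_proj : ∀ v, ∑ g, proj g v = v
  proj_act : ∀ g h v, proj g (act h v) = act h (proj g v)

namespace YetterDrinfeld

section Module
variable {k Γ V : Type*} [Field k] [CommGroup Γ] [Fintype Γ] [AddCommGroup V] [Module k V]
  [YetterDrinfeld k Γ V]

theorem proj_proj_self (g : Γ) (v : V) : proj k g (proj k g v) = proj k g v := by
  have h := congrArg (proj k g) (sum_proj (k := k) (Γ := Γ) v)
  rw [map_sum, Finset.sum_eq_single g] at h
  · exact h
  · intro b _ hb; exact proj_proj_of_ne _ _ _ hb.symm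
  · simp

theorem proj_proj [DecidableEq Γ] (g h : Γ) (v : V) :
    proj k g (proj k h v) = if g = h then proj k g v else 0 := by
  split_ifs with e
  · subst e; exact proj_proj_self g v
  · exact proj_proj_of_ne _ _ _ e

theorem act_act_comm (g h : Γ) (v : V) : act k g (act k h v) = act k h (act k g v) := by
  rw [← Module.End.mul_apply, ← Module.End.mul_apply, ← map_mul, ← map_mul, mul_comm]

variable (k) in
/-- The subspace `V^χ_g` of all `v` with coaction `δ v = g ⊗ v` (i.e. homogeneous of degree `g`) and
action `h • v = χ h v` for all `h ∈ Γ`. -/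
def isotypic (g : Γ) (χ : Γ →* kˣ) : Submodule k V where
  carrier := {v | proj k g v = v ∧ ∀ h : Γ, act k h v = (χ h : k) • v}
  add_mem' := by
    rintro a b ⟨ha, ha'⟩ ⟨hb, hb'⟩
    exact ⟨by rw [map_add, ha, hb], fun h => by rw [map_add, ha', hb', smul_add]⟩
  zero_mem' := ⟨map_zero _, fun h => by simp⟩
  smul_mem' := by
    rintro c a ⟨ha, ha'⟩
    exact ⟨by rw [map_smul, ha], fun h => by rw [map_smul, ha', smul_comm]⟩

end Module
end YetterDrinfeld

open YetterDrinfeld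

/-- An algebra in the category of Yetter-Drinfeld modules over `k[Γ]`: `Γ` acts by algebra
automorphisms, and the algebra is `Γ`-graded (`1` has degree `1`, and the component of degree `g`
of a product is `∑ a, x_a y_{a⁻¹ g}`). -/
class YDAlgebra (k Γ A : Type*) [Field k] [CommGroup Γ] [Fintype Γ] [Ring A] [Algebra k A]
    extends YetterDrinfeld k Γ A where
  act_one : ∀ g : Γ, act g 1 = 1
  act_mul : ∀ (g : Γ) (x y : A), act g (x * y) = act g x * act g y
  proj_one : proj 1 1 = 1
  proj_mul : ∀ (g : Γ) (x y : A), proj g (x * y) = ∑ a, proj a x * proj (a⁻¹ * g) y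

open YDAlgebra

section BT
variable (k Γ A B : Type*) [Field k] [CommGroup Γ] [Fintype Γ] [Ring A] [Algebra k A]
  [Ring B] [Algebra k B]

/-- The vector space `A ⊗ B`, to be equipped with the braided multiplication
`(x ⊗ y)(x' ⊗ y') = x (y₍₋₁₎ • x') ⊗ y₍₀₎ y'`. -/
@[nolint unusedArguments]
def BraidedTensor (k Γ A B : Type*) [Field k] [CommGroup Γ] [Ring A] [Algebra k A]
  [Ring B] [Algebra k B] : Type _ := A ⊗[k] B

namespace BraidedTensor

instance : AddCommGroup (BraidedTensor k Γ A B) := inferInstanceAs (AddCommGroup (A ⊗[k] B))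
instance : Module k (BraidedTensor k Γ A B) := inferInstanceAs (Module k (A ⊗[k] B))

/-- The identity map from `A ⊗ B` to its copy carrying the braided multiplication. -/
def of : A ⊗[k] B ≃ₗ[k] BraidedTensor k Γ A B := LinearEquiv.refl k _

variable [YDAlgebra k Γ A] [YDAlgebra k Γ B]

/-- The braided multiplication on `A ⊗ B`:
`(x ⊗ y)(x' ⊗ y') = ∑ g, x (g • x') ⊗ y_g y'`, see `mulMap_tmul`. -/
def mulMap : A ⊗[k] B →ₗ[k] A ⊗[k] B →ₗ[k] A ⊗[k] B :=
  ∑ g : Γ, TensorProduct.map₂ ((LinearMap.mul k A).compl₂ (act k g))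
    (LinearMap.mul k B ∘ₗ proj k g)

variable {k Γ A B}

theorem mulMap_tmul (x x' : A) (y y' : B) :
    mulMap k Γ A B (x ⊗ₜ y) (x' ⊗ₜ y') =
      ∑ g : Γ, (x * act k g x') ⊗ₜ (proj k g y * y') := by
  simp [mulMap, LinearMap.sum_apply]

theorem proj_one_of_ne {g : Γ} (hg : g ≠ 1) : proj k g (1 : B) = 0 := by
  rw [← proj_one (k := k) (Γ := Γ) (A := B)]; exact proj_proj_of_ne _ _ _ hg

theorem mulMap_one (t : A ⊗[k] B) : mulMap k Γ A B t (1 ⊗ₜ 1) = t := by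
  induction t with
  | zero => simp
  | add a b ha hb => rw [map_add, LinearMap.add_apply, ha, hb]
  | tmul x y => simp [mulMap_tmul, act_one, ← TensorProduct.tmul_sum, sum_proj]

theorem one_mulMap (t : A ⊗[k] B) : mulMap k Γ A B (1 ⊗ₜ 1) t = t := by
  induction t with
  | zero => simp
  | add a b ha hb => rw [map_add, ha, hb]
  | tmul x y =>
    rw [mulMap_tmul, Finset.sum_eq_single 1]
    · simp [proj_one]
    · intro g _ hg; simp [proj_one_of_ne hg]
    · simp

theorem proj_proj_mul (g h : Γ) (x y : B) :
    proj k h (proj k g x * y) = proj k g x * proj k (g⁻¹ * h) y := by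
  rw [proj_mul, Finset.sum_eq_single g]
  · rw [proj_proj_self]
  · intro b _ hb; rw [proj_proj_of_ne _ _ _ hb, zero_mul]
  · simp

theorem mulMap_assoc (r s t : A ⊗[k] B) :
    mulMap k Γ A B (mulMap k Γ A B r s) t = mulMap k Γ A B r (mulMap k Γ A B s t) := by
  induction r with
  | zero => simp
  | add a b ha hb => simp only [map_add, LinearMap.add_apply, ha, hb]
  | tmul x y =>
  induction s with
  | zero => simp
  | add a b ha hb => simp only [map_add, LinearMap.add_apply, ha, hb]
  | tmul x' y' =>
  induction t with
  | zero => simp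
  | add a b ha hb => simp only [map_add, ha, hb]
  | tmul x'' y'' =>
    simp only [mulMap_tmul, map_sum, LinearMap.sum_apply]
    conv_rhs => rw [Finset.sum_comm]
    refine Finset.sum_congr rfl fun g _ => ?_
    refine (Fintype.sum_equiv (Equiv.mulLeft g) _ _ fun h => ?_).symm
    simp [proj_proj_mul, act_mul, mul_assoc]

instance : Mul (BraidedTensor k Γ A B) where
  mul s t := of k Γ A B (mulMap k Γ A B ((of k Γ A B).symm s) ((of k Γ A B).symm t))

instance : One (BraidedTensor k Γ A B) where
  one := of k Γ A B (1 ⊗ₜ 1)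

instance : Ring (BraidedTensor k Γ A B) where
  __ := (inferInstance : AddCommGroup (BraidedTensor k Γ A B))
  left_distrib r s t := (mulMap k Γ A B r).map_add s t
  right_distrib r s t := (mulMap k Γ A B).map_add₂ r s t
  zero_mul t := (mulMap k Γ A B).map_zero₂ t
  mul_zero t := (mulMap k Γ A B t).map_zero
  mul_assoc := mulMap_assoc
  one_mul := one_mulMap
  mul_one := mulMap_one

instance : Algebra k (BraidedTensor k Γ A B) :=
  Algebra.ofModule (fun r s t => by exact LinearMap.map_smul₂ (mulMap k Γ A B) r s t)
   (fun r s t => by exact map_smul (mulMap k Γ A B s) r t)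

theorem of_mul_of (s t : A ⊗[k] B) :
    of k Γ A B s * of k Γ A B t = of k Γ A B (mulMap k Γ A B s t) := rfl

instance [FiniteDimensional k A] [FiniteDimensional k B] :
    FiniteDimensional k (BraidedTensor k Γ A B) :=
  inferInstanceAs (FiniteDimensional k (A ⊗[k] B))

end BraidedTensor
end BT

section GroupAlgebra
variable (k Γ : Type*) [Field k] [CommGroup Γ] [Fintype Γ]

open Classical in
/-- The group algebra `k[Γ]` as an algebra in Yetter-Drinfeld modules: the adjoint action, which is
trivial because `Γ` is abelian, and the grading for which `h ∈ Γ` has degree `h`. -/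
instance groupAlgebraYD : YDAlgebra k Γ (MonoidAlgebra k Γ) where
  act := 1
  proj g := MonoidAlgebra.lsingle g ∘ₗ Finsupp.lapply g ∘ₗ
    (MonoidAlgebra.coeffLinearEquiv k : MonoidAlgebra k Γ ≃ₗ[k] (Γ →₀ k)).toLinearMap
  proj_proj_of_ne g h v hgh := by
    simp [hgh.symm]
  sum_proj v := by
    ext a
    simp
  proj_act g h v := rfl
  act_one _ := rfl
  act_mul _ _ _ := rfl
  proj_one := by simp [MonoidAlgebra.one_def]
  proj_mul g x y := by
    induction x using MonoidAlgebra.induction_linear with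
    | zero => simp
    | add a b ha hb => simp only [add_mul, map_add, ha, hb, Finset.sum_add_distrib]
    | single a r =>
    induction y using MonoidAlgebra.induction_linear with
    | zero => simp
    | add a b ha hb => simp only [mul_add, map_add, ha, hb, Finset.sum_add_distrib]
    | single b s =>
    rw [Finset.sum_eq_single a]
    · by_cases h : a * b = g
      · subst h; simp [MonoidAlgebra.single_mul_single]
      · have h' : b ≠ a⁻¹ * g := fun e => h (by rw [e]; simp)
        simp [MonoidAlgebra.single_mul_single, h, h']
    · intro c _ hc
      simp [Finsupp.single_apply, hc.symm]
    · simp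

variable {k Γ}
theorem groupAlgebra_act (g : Γ) (x : MonoidAlgebra k Γ) : act k g x = x := rfl

open Classical in
theorem groupAlgebra_proj_single (g h : Γ) (r : k) :
    proj k g (MonoidAlgebra.single h r) = if g = h then MonoidAlgebra.single h r else 0 := by
  by_cases e : g = h
  · subst e; simp [proj]
  · simp [proj, e]
end GroupAlgebra

/-- A bialgebra in the braided category of Yetter-Drinfeld modules over `k[Γ]`: the
comultiplication is an algebra map into the braided tensor square, the counit is an algebra map,
both are maps of Yetter-Drinfeld modules, and the coassociativity and counit laws hold. -/
class BraidedBialgebra (k Γ A : Type*) [Field k] [CommGroup Γ] [Fintype Γ] [Ring A]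
    [Algebra k A] extends YDAlgebra k Γ A where
  bcomul (k Γ) : A →ₗ[k] A ⊗[k] A
  bcounit (k Γ) : A →ₐ[k] k
  bcomul_one : bcomul 1 = 1 ⊗ₜ 1
  bcomul_mul : ∀ x y : A, bcomul (x * y) = BraidedTensor.mulMap k Γ A A (bcomul x) (bcomul y)
  bcomul_act : ∀ (g : Γ) (x : A), bcomul (act g x) =
    TensorProduct.map (act g) (act g) (bcomul x)
  bcomul_proj : ∀ (g : Γ) (x : A), bcomul (proj g x) =
    ∑ a, TensorProduct.map (proj a) (proj (a⁻¹ * g)) (bcomul x)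
  bcounit_act : ∀ (g : Γ) (x : A), bcounit (act g x) = bcounit x
  bcounit_proj : ∀ (g : Γ) (x : A), g ≠ 1 → bcounit (proj g x) = 0
  bcoassoc : ∀ x : A, TensorProduct.assoc k A A A (bcomul.rTensor A (bcomul x)) =
    bcomul.lTensor A (bcomul x)
  rTensor_bcounit_bcomul : ∀ x : A,
    bcounit.toLinearMap.rTensor A (bcomul x) = (1 : k) ⊗ₜ[k] x
  lTensor_bcounit_bcomul : ∀ x : A,
    bcounit.toLinearMap.lTensor A (bcomul x) = x ⊗ₜ[k] (1 : k)

open BraidedBialgebra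

section Bos

/-- The bosonization (Radford biproduct) `A # k[Γ]`. As an algebra it is the smash product, i.e. the
vector space `A ⊗ k[Γ]` with `(x # g)(y # h) = x (g • y) # g h`, see `Bosonization.mk_mul_mk`. -/
abbrev Bosonization (k Γ A : Type*) [Field k] [CommGroup Γ] [Ring A] [Algebra k A] :=
  BraidedTensor k Γ A (MonoidAlgebra k Γ)

namespace Bosonization
variable (k Γ A : Type*) [Field k] [CommGroup Γ] [Fintype Γ] [Ring A] [Algebra k A]
  [BraidedBialgebra k Γ A]

open MonoidAlgebra (single)

/-- The smash coproduct `Δ (x # h) = ∑ g, (x⁽¹⁾ # g h) ⊗ ((x⁽²⁾)_g # h)`, that is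
`Δ (x # h) = (x⁽¹⁾ # x⁽²⁾₍₋₁₎ h) ⊗ (x⁽²⁾₍₀₎ # h)`, and the counit `ε (x # h) = ε x`. -/
instance : CoalgebraStruct k (Bosonization k Γ A) where
  comul := TensorProduct.map (BraidedTensor.of k Γ A (MonoidAlgebra k Γ)).toLinearMap
      (BraidedTensor.of k Γ A (MonoidAlgebra k Γ)).toLinearMap ∘ₗ
    (∑ g : Γ, TensorProduct.map
      ((LinearMap.mulLeft k (single g (1 : k))).lTensor A)
      ((proj k g).rTensor (MonoidAlgebra k Γ))) ∘ₗ
    (TensorProduct.tensorTensorTensorComm k A A (MonoidAlgebra k Γ)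
      (MonoidAlgebra k Γ)).toLinearMap ∘ₗ
    TensorProduct.map (bcomul k Γ) (Coalgebra.comul (R := k) (A := MonoidAlgebra k Γ)) ∘ₗ
    (BraidedTensor.of k Γ A (MonoidAlgebra k Γ)).symm.toLinearMap
  counit := LinearMap.mul' k k ∘ₗ
    TensorProduct.map (bcounit k Γ).toLinearMap
      (Coalgebra.counit (R := k) (A := MonoidAlgebra k Γ)) ∘ₗ
    (BraidedTensor.of k Γ A (MonoidAlgebra k Γ)).symm.toLinearMap

variable {k A}

/-- The element `x # h`. -/
def mk (x : A) (h : Γ) : Bosonization k Γ A :=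
  BraidedTensor.of k Γ A (MonoidAlgebra k Γ) (x ⊗ₜ single h 1)

variable {Γ}
theorem induction_on {P : Bosonization k Γ A → Prop} (t : Bosonization k Γ A)
    (zero : P 0) (add : ∀ s t, P s → P t → P (s + t)) (h : ∀ x h, P (mk Γ x h)) : P t := by
  refine TensorProduct.induction_on (motive := P) t zero (fun x y => ?_) add
  induction y using MonoidAlgebra.induction_linear with
  | zero => rw [TensorProduct.tmul_zero]; exact zero
  | add a b ha hb => rw [TensorProduct.tmul_add]; exact add _ _ ha hb
  | single a r =>
    have := h (r • x) a
    rw [mk, TensorProduct.smul_tmul, MonoidAlgebra.smul_single, smul_eq_mul, mul_one] at this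
    exact this

/-- The linear map `x ↦ x # h`. -/
def mkₗ (h : Γ) : A →ₗ[k] Bosonization k Γ A :=
  (BraidedTensor.of k Γ A (MonoidAlgebra k Γ)).toLinearMap ∘ₗ
    (TensorProduct.mk k A (MonoidAlgebra k Γ)).flip (single h 1)

theorem mk_eq (x : A) (h : Γ) : mk (k := k) Γ x h = mkₗ h x := rfl

theorem mk_mul_mk (x y : A) (g h : Γ) :
    mkₗ (k := k) g x * mkₗ h y = mkₗ (g * h) (x * act k g y) := by
  change BraidedTensor.of k Γ A (MonoidAlgebra k Γ)
    (BraidedTensor.mulMap k Γ A (MonoidAlgebra k Γ) (x ⊗ₜ single g 1) (y ⊗ₜ single h 1)) = _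
  rw [BraidedTensor.mulMap_tmul, Finset.sum_eq_single g]
  · simp [groupAlgebra_proj_single, mkₗ, MonoidAlgebra.single_mul_single]
  · intro b _ hb; simp [groupAlgebra_proj_single, hb]
  · simp

/-- The map `x ⊗ y ↦ ∑ g, (x # g h) ⊗ (y_g # h)`; thus `Δ (x # h) = Θ h (Δ x)`. -/
def Θ (h : Γ) : A ⊗[k] A →ₗ[k] Bosonization k Γ A ⊗[k] Bosonization k Γ A :=
  ∑ g : Γ, TensorProduct.map (mkₗ (g * h)) (mkₗ h ∘ₗ proj k g)

theorem Θ_tmul (h : Γ) (x y : A) : Θ (k := k) h (x ⊗ₜ y) =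
    ∑ g : Γ, mkₗ (g * h) x ⊗ₜ mkₗ h (proj k g y) := by
  simp [Θ, LinearMap.sum_apply]

theorem comul_mk (h : Γ) (x : A) : Coalgebra.comul (R := k) (mkₗ (k := k) h x) =
    Θ h (bcomul k Γ x) := by
  simp only [Coalgebra.comul, LinearMap.comp_apply, mkₗ, LinearEquiv.coe_coe,
    LinearEquiv.symm_apply_apply, LinearMap.flip_apply, TensorProduct.mk_apply,
    TensorProduct.map_tmul]
  have : (CoalgebraStruct.comul (R := k) (single h (1:k))) = single h (1:k) ⊗ₜ[k] single h (1:k) := by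
    simp
  erw [this]
  induction bcomul k Γ x with
  | zero => simp
  | add a b ha hb => simp only [TensorProduct.add_tmul, map_add, ha, hb]
  | tmul y z =>
    rw [TensorProduct.tensorTensorTensorComm_tmul, Θ_tmul]
    simp [LinearMap.sum_apply, mkₗ, MonoidAlgebra.single_mul_single]

theorem counit_mk (h : Γ) (x : A) : Coalgebra.counit (R := k) (mkₗ (k := k) h x) =
    bcounit k Γ x := by
  simp only [Coalgebra.counit, LinearMap.comp_apply, mkₗ, LinearEquiv.coe_coe,
    LinearEquiv.symm_apply_apply, LinearMap.flip_apply, TensorProduct.mk_apply,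
    TensorProduct.map_tmul]
  have : (CoalgebraStruct.counit (R := k) (single h (1:k))) = (1 : k) := by
    simp
  erw [this]
  simp


theorem bcounit_proj_one (x : A) : bcounit k Γ (proj k (1 : Γ) x) = bcounit k Γ x := by
  have h : bcounit k Γ (∑ g : Γ, proj k g x) = bcounit k Γ x := by rw [sum_proj]
  rw [← h, map_sum, Finset.sum_eq_single 1]
  · intro b _ hb; exact bcounit_proj _ _ hb
  · simp

theorem linearMap_ext {M : Type*} [AddCommMonoid M] [Module k M]
    {f f' : Bosonization k Γ A →ₗ[k] M} (H : ∀ h x, f (mkₗ h x) = f' (mkₗ h x)) : f = f' := by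
  ext t
  induction t using induction_on with
  | zero => simp
  | add s t hs ht => simp [hs, ht]
  | h x h => exact H h x

theorem Θ_bcomul_proj (h g : Γ) (y : A) :
    Θ (k := k) h (bcomul k Γ (proj k g y)) = ∑ a, TensorProduct.map (mkₗ ((a⁻¹ * g) * h) ∘ₗ proj k a)
      (mkₗ h ∘ₗ proj k (a⁻¹ * g)) (bcomul k Γ y) := by
  rw [bcomul_proj, map_sum]
  refine Finset.sum_congr rfl fun a _ => ?_
  induction bcomul k Γ y with
  | zero => simp
  | add a b ha hb => simp only [map_add, ha, hb]
  | tmul y z =>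
    rw [TensorProduct.map_tmul, Θ_tmul, Finset.sum_eq_single (a⁻¹ * g)]
    · simp [proj_proj_self]
    · intro b _ hb; rw [proj_proj_of_ne _ _ _ hb]; simp
    · simp

theorem coassoc_aux (h : Γ) (x : A) :
    TensorProduct.assoc k _ _ _ ((Coalgebra.comul (R := k) (A := Bosonization k Γ A)).rTensor _
      (Coalgebra.comul (R := k) (mkₗ (k := k) h x))) =
    (Coalgebra.comul (R := k) (A := Bosonization k Γ A)).lTensor _
      (Coalgebra.comul (R := k) (mkₗ (k := k) h x)) := by
  have hl : ∀ t : A ⊗[k] A,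
      (Coalgebra.comul (R := k) (A := Bosonization k Γ A)).rTensor _ (Θ h t) =
      ∑ g : Γ, TensorProduct.map (Θ (g * h)) (mkₗ h ∘ₗ proj k g) ((bcomul k Γ).rTensor A t) := by
    intro t
    induction t with
    | zero => simp
    | add a b ha hb => simp only [map_add, ha, hb, Finset.sum_add_distrib]
    | tmul y z => simp [Θ_tmul, comul_mk]
  have hr : ∀ t : A ⊗[k] A,
      (Coalgebra.comul (R := k) (A := Bosonization k Γ A)).lTensor _ (Θ h t) =
      ∑ g : Γ, ∑ a : Γ, TensorProduct.map (mkₗ (g * h))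
        (TensorProduct.map (mkₗ ((a⁻¹ * g) * h) ∘ₗ proj k a) (mkₗ h ∘ₗ proj k (a⁻¹ * g)))
        ((bcomul k Γ).lTensor A t) := by
    intro t
    induction t with
    | zero => simp
    | add a b ha hb => simp only [map_add, ha, hb, Finset.sum_add_distrib]
    | tmul y z => simp [Θ_tmul, comul_mk, Θ_bcomul_proj, TensorProduct.tmul_sum]
  rw [comul_mk, hl, hr, ← bcoassoc]
  generalize (bcomul k Γ).rTensor A (bcomul k Γ x) = t
  induction t with
  | zero => simp
  | add a b ha hb => simp only [map_add, ha, hb, Finset.sum_add_distrib]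
  | tmul t z =>
  induction t with
  | zero => simp
  | add a b ha hb => simp only [map_add, TensorProduct.add_tmul, ha, hb, Finset.sum_add_distrib]
  | tmul x y =>
    simp only [TensorProduct.map_tmul, Θ_tmul, TensorProduct.sum_tmul, map_sum,
      TensorProduct.assoc_tmul, LinearMap.comp_apply]
    rw [Finset.sum_comm]
    conv_rhs => rw [Finset.sum_comm]
    refine Finset.sum_congr rfl fun a _ => ?_
    refine Fintype.sum_equiv (Equiv.mulLeft a) _ _ fun g => ?_
    simp [mul_assoc]

instance : Coalgebra k (Bosonization k Γ A) where
  coassoc := linearMap_ext fun h x => coassoc_aux h x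
  rTensor_counit_comp_comul := linearMap_ext fun h x => by
    rw [LinearMap.comp_apply, comul_mk]
    have : ∀ t : A ⊗[k] A, (Coalgebra.counit (R := k) (A := Bosonization k Γ A)).rTensor _ (Θ h t) =
        (mkₗ h).lTensor k ((bcounit k Γ).toLinearMap.rTensor A t) := by
      intro t
      induction t with
      | zero => simp
      | add a b ha hb => simp only [map_add, ha, hb]
      | tmul y z =>
        rw [Θ_tmul, map_sum]
        simp only [LinearMap.rTensor_tmul, counit_mk]
        rw [← TensorProduct.tmul_sum, ← map_sum, sum_proj]
        simp
    rw [this, rTensor_bcounit_bcomul]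
    simp
  lTensor_counit_comp_comul := linearMap_ext fun h x => by
    rw [LinearMap.comp_apply, comul_mk]
    have : ∀ t : A ⊗[k] A, (Coalgebra.counit (R := k) (A := Bosonization k Γ A)).lTensor _ (Θ h t) =
        (mkₗ h).rTensor k ((bcounit k Γ).toLinearMap.lTensor A t) := by
      intro t
      induction t with
      | zero => simp
      | add a b ha hb => simp only [map_add, ha, hb]
      | tmul y z =>
        rw [Θ_tmul, map_sum, Finset.sum_eq_single 1]
        · simp [counit_mk, bcounit_proj_one]
        · intro b _ hb
          rw [LinearMap.lTensor_tmul, counit_mk, bcounit_proj _ _ hb]; simp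
        · simp
    rw [this, lTensor_bcounit_bcomul]
    simp

theorem one_eq : (1 : Bosonization k Γ A) = mkₗ 1 1 := rfl

theorem Θ_mul_Θ (g h : Γ) (s t : A ⊗[k] A) : Θ g s * Θ h t =
    Θ (k := k) (g * h) (BraidedTensor.mulMap k Γ A A s
      (TensorProduct.map (act k g) (act k g) t)) := by
  induction s with
  | zero => simp
  | add a b ha hb => simp only [map_add, LinearMap.add_apply, add_mul, ha, hb]
  | tmul x y =>
  induction t with
  | zero => simp
  | add a b ha hb => simp only [map_add, mul_add, ha, hb]
  | tmul x' y' =>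
    simp only [TensorProduct.map_tmul, BraidedTensor.mulMap_tmul, map_sum, Θ_tmul,
      Finset.sum_mul, Finset.mul_sum, Algebra.TensorProduct.tmul_mul_tmul, mk_mul_mk,
      BraidedTensor.proj_proj_mul, proj_act]
    rw [Finset.sum_comm]
    refine Finset.sum_congr rfl fun a _ => ?_
    refine Fintype.sum_equiv (Equiv.mulLeft a) _ _ fun b => ?_
    rw [act_act_comm a g]
    simp [mul_comm, mul_left_comm, mul_assoc]

/-- The Radford biproduct is an (ordinary) bialgebra. -/
instance : Bialgebra k (Bosonization k Γ A) :=
  Bialgebra.mk' k _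
    (by rw [one_eq, counit_mk, map_one])
    (by
      intro s t
      induction s using induction_on with
      | zero => simp
      | add s t hs ht => simp [add_mul, hs, ht]
      | h x g =>
      induction t using induction_on with
      | zero => simp
      | add s t hs ht => simp [mul_add, hs, ht]
      | h y h => simp only [mk_eq, mk_mul_mk, counit_mk, map_mul, bcounit_act])
    (by rw [one_eq, comul_mk, bcomul_one, Θ_tmul, Finset.sum_eq_single 1]
        · simp [proj_one]; rfl
        · intro b _ hb; simp [BraidedTensor.proj_one_of_ne hb]
        · simp)
    (by
      intro s t
      induction s using induction_on with
      | zero => simp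
      | add s t hs ht => simp [add_mul, hs, ht]
      | h x g =>
      induction t using induction_on with
      | zero => simp
      | add s t hs ht => simp [mul_add, hs, ht]
      | h y h =>
        simp only [mk_eq, mk_mul_mk, comul_mk, Θ_mul_Θ, bcomul_mul, bcomul_act])

end Bosonization
end Bos

section TensorAlg
namespace BraidedTensorAlgebra
variable (k : Type*) {Γ : Type*} (V : Type*) [Field k] [CommGroup Γ] [Fintype Γ]
  [AddCommGroup V] [Module k V] [YetterDrinfeld k Γ V]

open TensorAlgebra (ι)

/-- The action of `g` on the tensor algebra, by the algebra automorphism extending `act g`. -/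
def actHom (g : Γ) : TensorAlgebra k V →ₐ[k] TensorAlgebra k V :=
  TensorAlgebra.lift k (ι k ∘ₗ act k g)

variable (Γ) in
/-- The algebra map `T(V) → T(V)[Γ]` with `v ↦ ∑ g, v_g g`: the coaction on the tensor algebra. -/
def coact : TensorAlgebra k V →ₐ[k] MonoidAlgebra (TensorAlgebra k V) Γ :=
  TensorAlgebra.lift k (∑ g : Γ, MonoidAlgebra.lsingle g ∘ₗ ι k ∘ₗ proj k g)

/-- The homogeneous component of degree `g` in the tensor algebra. -/
def component (g : Γ) : TensorAlgebra k V →ₗ[k] TensorAlgebra k V :=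
  Finsupp.lapply g ∘ₗ (MonoidAlgebra.coeffLinearEquiv k).toLinearMap ∘ₗ (coact k Γ V).toLinearMap

variable {k V}

theorem actHom_ι (g : Γ) (v : V) : actHom k V g (ι k v) = ι k (act k g v) := by simp [actHom]

open Classical in
theorem component_ι (g : Γ) (v : V) : component k V g (ι k v) = ι k (proj k g v) := by
  simp [component, coact, LinearMap.sum_apply, Finsupp.single_apply]

open Classical in
theorem component_algebraMap (g : Γ) (r : k) :
    component k V g (algebraMap k _ r) = if g = 1 then algebraMap k _ r else 0 := by
  simp [component, Finsupp.single_apply, eq_comm]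

theorem component_mul (g : Γ) (x y : TensorAlgebra k V) :
    component k V g (x * y) = ∑ a, component k V a x * component k V (a⁻¹ * g) y := by
  simp only [component, LinearMap.comp_apply, AlgHom.toLinearMap_apply, map_mul]
  generalize coact k Γ V x = x
  generalize coact k Γ V y = y
  induction x using MonoidAlgebra.induction_linear with
  | zero => simp
  | add a b ha hb => simp only [add_mul, map_add, ha, hb, Finset.sum_add_distrib]
  | single a r =>
  induction y using MonoidAlgebra.induction_linear with
  | zero => simp
  | add a b ha hb => simp only [mul_add, map_add, ha, hb, Finset.sum_add_distrib]
  | single b s =>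
  classical
  rw [Finset.sum_eq_single a]
  · by_cases h : a * b = g
    · subst h; simp [MonoidAlgebra.single_mul_single]
    · have h' : b ≠ a⁻¹ * g := fun e => h (by rw [e]; simp)
      simp [MonoidAlgebra.single_mul_single, h, h']
  · intro c _ hc
    simp [Finsupp.single_apply, hc.symm]
  · simp

open Classical in
theorem component_component (g h : Γ) (x : TensorAlgebra k V) :
    component k V g (component k V h x) = if g = h then component k V g x else 0 := by
  induction x using TensorAlgebra.induction generalizing g h with
  | algebraMap r =>
    rw [component_algebraMap, component_algebraMap]
    by_cases e : g = h
    · subst e; split_ifs <;> simp_all [component_algebraMap]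
    · split_ifs <;> simp_all [component_algebraMap]
  | ι v =>
    rw [component_ι, component_ι, component_ι, proj_proj]
    split_ifs <;> simp
  | add x y hx hy => simp only [map_add, hx, hy]; split_ifs <;> simp
  | mul x y hx hy =>
    rw [component_mul h, map_sum]
    simp only [component_mul g, hx, hy]
    by_cases e : g = h
    · subst e
      rw [if_pos rfl]
      refine Finset.sum_congr rfl fun a _ => ?_
      rw [Finset.sum_eq_single a]
      · simp
      · intro b _ hb; simp [hb]
      · simp
    · rw [if_neg e]
      refine Finset.sum_eq_zero fun a _ => Finset.sum_eq_zero fun b _ => ?_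
      by_cases hb : b = a
      · subst hb; simp [e]
      · simp [hb]

theorem sum_component (x : TensorAlgebra k V) : ∑ g : Γ, component k V g x = x := by
  classical
  induction x using TensorAlgebra.induction with
  | algebraMap r => simp [component_algebraMap]
  | ι v => simp only [component_ι]; rw [← map_sum, sum_proj]
  | add x y hx hy => simp only [map_add, Finset.sum_add_distrib, hx, hy]
  | mul x y hx hy =>
    simp only [component_mul]
    rw [Finset.sum_comm]
    conv_rhs => rw [← hx, ← hy, Finset.sum_mul]
    refine Finset.sum_congr rfl fun a _ => ?_
    rw [← Finset.mul_sum]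
    congr 1
    exact Fintype.sum_equiv (Equiv.mulLeft a⁻¹) _ _ fun b => rfl

theorem component_actHom (g h : Γ) (x : TensorAlgebra k V) :
    component k V g (actHom k V h x) = actHom k V h (component k V g x) := by
  classical
  induction x using TensorAlgebra.induction generalizing g with
  | algebraMap r =>
    rw [AlgHom.commutes, component_algebraMap]; split_ifs <;> simp
  | ι v => rw [actHom_ι, component_ι, component_ι, actHom_ι, proj_act]
  | add x y hx hy => simp only [map_add, hx, hy]
  | mul x y hx hy => simp only [component_mul, map_mul, map_sum, hx, hy]

/-- The tensor algebra as an algebra in Yetter-Drinfeld modules, with the action and grading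
extending those of `V`. -/
instance : YDAlgebra k Γ (TensorAlgebra k V) where
  act :=
    { toFun g := (actHom k V g).toLinearMap
      map_one' := by
        have : actHom k V (1 : Γ) = AlgHom.id k _ := by ext; simp [actHom]
        rw [this]; rfl
      map_mul' g h := by
        have : actHom k V (g * h) = (actHom k V g).comp (actHom k V h) := by
          ext; simp [actHom]
        rw [this]; rfl }
  proj := component k V
  proj_proj_of_ne g h v hgh := by classical rw [component_component, if_neg hgh]
  sum_proj := sum_component
  proj_act := component_actHom
  act_one g := map_one (actHom k V g)
  act_mul g := map_mul (actHom k V g)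
  proj_one := by
    classical
    have := component_algebraMap (k := k) (V := V) (1 : Γ) 1
    rwa [if_pos rfl, map_one] at this
  proj_mul := component_mul

variable (k Γ V) in
/-- The algebra map from `T(V)` to its braided tensor square with `v ↦ v ⊗ 1 + 1 ⊗ v`. -/
def comul : TensorAlgebra k V →ₐ[k] BraidedTensor k Γ (TensorAlgebra k V) (TensorAlgebra k V) :=
  TensorAlgebra.lift k
    ((BraidedTensor.of k Γ (TensorAlgebra k V) (TensorAlgebra k V)).toLinearMap ∘ₗ
      ((TensorProduct.mk k (TensorAlgebra k V) (TensorAlgebra k V)).flip 1 +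
        TensorProduct.mk k (TensorAlgebra k V) (TensorAlgebra k V) 1) ∘ₗ ι k)

variable (k Γ V) in
/-- The braided comultiplication of `T(V)` as a linear map. -/
def comulₗ : TensorAlgebra k V →ₗ[k] TensorAlgebra k V ⊗[k] TensorAlgebra k V :=
  (BraidedTensor.of k Γ (TensorAlgebra k V) (TensorAlgebra k V)).symm.toLinearMap ∘ₗ
    (comul k Γ V).toLinearMap

theorem comulₗ_one : comulₗ k Γ V 1 = 1 ⊗ₜ 1 := map_one (comul k Γ V)

theorem comulₗ_mul (x y : TensorAlgebra k V) : comulₗ k Γ V (x * y) =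
    BraidedTensor.mulMap k Γ _ _ (comulₗ k Γ V x) (comulₗ k Γ V y) := map_mul (comul k Γ V) x y

theorem comulₗ_ι (v : V) : comulₗ k Γ V (ι k v) = ι k v ⊗ₜ 1 + 1 ⊗ₜ ι k v := by
  simp [comulₗ, comul]

theorem left_induction {P : TensorAlgebra k V → Prop} (x : TensorAlgebra k V)
    (one : P 1) (smul : ∀ (r : k) x, P x → P (r • x)) (add : ∀ x y, P x → P y → P (x + y))
    (mul : ∀ v x, P x → P (ι k v * x)) : P x := by
  have : ∀ y, P y → P (x * y) := by
    induction x using TensorAlgebra.induction with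
    | algebraMap r => intro y hy; rw [← Algebra.smul_def]; exact smul _ _ hy
    | ι v => exact mul v
    | add a b ha hb => intro y hy; rw [add_mul]; exact add _ _ (ha y hy) (hb y hy)
    | mul a b ha hb => intro y hy; rw [mul_assoc]; exact ha _ (hb y hy)
  simpa using this 1 one

variable (Γ) in
/-- Left multiplication by `v ⊗ 1 + 1 ⊗ v` in the braided tensor square. -/
def L (v : V) : TensorAlgebra k V ⊗[k] TensorAlgebra k V →ₗ[k]
    TensorAlgebra k V ⊗[k] TensorAlgebra k V :=
  (LinearMap.mulLeft k (ι k v)).rTensor _ +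
    ∑ g : Γ, TensorProduct.map (act k g) (LinearMap.mulLeft k (ι k (proj k g v)))

theorem proj_ι (g : Γ) (v : V) : proj k g (ι k v) = ι k (proj k g v) := component_ι g v
theorem act_ι (g : Γ) (v : V) : act k g (ι k v) = ι k (act k g v) := actHom_ι g v

theorem L_tmul (v : V) (x y : TensorAlgebra k V) : L Γ v (x ⊗ₜ[k] y) =
    (ι k v * x) ⊗ₜ y + ∑ g : Γ, act k g x ⊗ₜ (ι k (proj k g v) * y) := by
  simp [L, LinearMap.sum_apply]

theorem comulₗ_ι_mul (v : V) (x : TensorAlgebra k V) :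
    comulₗ k Γ V (ι k v * x) = L Γ v (comulₗ k Γ V x) := by
  rw [comulₗ_mul, comulₗ_ι]
  induction comulₗ k Γ V x with
  | zero => simp
  | add a b ha hb =>
    rw [map_add (L Γ v), ← ha, ← hb]
    exact map_add _ _ _
  | tmul x y =>
    rw [L_tmul, map_add, LinearMap.add_apply, BraidedTensor.mulMap_tmul, BraidedTensor.mulMap_tmul]
    congr 1
    · rw [Finset.sum_eq_single 1]
      · simp [proj_one]
      · intro b _ hb; simp [BraidedTensor.proj_one_of_ne hb]
      · simp
    · simp [proj_ι]

theorem comulₗ_act (g : Γ) (x : TensorAlgebra k V) : comulₗ k Γ V (act k g x) =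
    TensorProduct.map (act k g) (act k g) (comulₗ k Γ V x) := by
  induction x using left_induction with
  | one => simp [act_one, comulₗ_one]
  | smul r x hx => simp [hx]
  | add x y hx hy => simp [hx, hy]
  | mul v x hx =>
    rw [act_mul, act_ι, comulₗ_ι_mul, comulₗ_ι_mul, hx]
    induction comulₗ k Γ V x with
    | zero => simp
    | add a b ha hb => simp only [map_add, ha, hb]
    | tmul x y =>
      simp only [TensorProduct.map_tmul, L_tmul, map_add, map_sum, act_mul, act_ι, proj_act]
      congr 1
      exact Finset.sum_congr rfl fun h _ => by rw [act_act_comm]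

theorem comulₗ_proj (g : Γ) (x : TensorAlgebra k V) : comulₗ k Γ V (proj k g x) =
    ∑ a, TensorProduct.map (proj k a) (proj k (a⁻¹ * g)) (comulₗ k Γ V x) := by
  classical
  induction x using left_induction generalizing g with
  | one =>
    rw [comulₗ_one, Finset.sum_eq_single 1]
    · by_cases h : g = 1
      · subst h; simp [proj_one, comulₗ_one]
      · simp [BraidedTensor.proj_one_of_ne h]
    · intro b _ hb; simp [BraidedTensor.proj_one_of_ne hb]
    · simp
  | smul r x hx => simp [hx, Finset.smul_sum]
  | add x y hx hy => simp [hx, hy, Finset.sum_add_distrib]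
  | mul v x hx =>
    rw [proj_mul, comulₗ_ι_mul, map_sum]
    simp only [proj_ι, comulₗ_ι_mul, hx]
    induction comulₗ k Γ V x with
    | zero => simp
    | add a b ha hb => simp only [map_add, Finset.sum_add_distrib, ha, hb]
    | tmul x y =>
      simp only [TensorProduct.map_tmul, L_tmul, map_add, map_sum, Finset.sum_add_distrib]
      congr 1
      · simp only [proj_mul, proj_ι, TensorProduct.sum_tmul]
        conv_rhs => rw [Finset.sum_comm]
        refine Finset.sum_congr rfl fun b _ => ?_
        refine Fintype.sum_equiv (Equiv.mulLeft b) _ _ fun a => ?_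
        simp [mul_assoc]
      · simp only [proj_mul, proj_ι, proj_act, TensorProduct.tmul_sum]
        rw [Finset.sum_comm]
        refine Finset.sum_congr rfl fun a _ => Finset.sum_congr rfl fun b _ => ?_
        rw [Finset.sum_eq_single b, Finset.sum_eq_single b, mul_left_comm]
        · intro c _ hc; rw [proj_proj_of_ne _ _ _ hc]; simp
        · simp
        · intro c _ hc; rw [proj_proj_of_ne _ _ _ hc]; simp
        · simp

theorem comulₗ_coassoc (x : TensorAlgebra k V) :
    TensorProduct.assoc k _ _ _ ((comulₗ k Γ V).rTensor _ (comulₗ k Γ V x)) =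
    (comulₗ k Γ V).lTensor _ (comulₗ k Γ V x) := by
  induction x using left_induction with
  | one => simp [comulₗ_one]
  | smul r x hx => simp [hx]
  | add x y hx hy => simp [hx, hy]
  | mul v x hx =>
    rw [comulₗ_ι_mul]
    have hr : ∀ t, (comulₗ k Γ V).rTensor _ (L Γ v t) =
      ((L Γ v).rTensor (TensorAlgebra k V) +
        ∑ g : Γ, TensorProduct.map (TensorProduct.map (act k g) (act k g))
          (LinearMap.mulLeft k (ι k (proj k g v))) :
        (TensorAlgebra k V ⊗[k] TensorAlgebra k V) ⊗[k] TensorAlgebra k V →ₗ[k] _) ((comulₗ k Γ V).rTensor _ t) := by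
      intro t
      induction t with
      | zero => simp
      | add a b ha hb => simp only [map_add, ha, hb]
      | tmul x y => simp [L_tmul, comulₗ_ι_mul, comulₗ_act, LinearMap.sum_apply]
    have hl : ∀ t, (comulₗ k Γ V).lTensor _ (L Γ v t) =
      ((LinearMap.mulLeft k (ι k v)).rTensor (TensorAlgebra k V ⊗[k] TensorAlgebra k V) +
        ∑ g : Γ, TensorProduct.map (act k g) (L Γ (proj k g v)) :
        TensorAlgebra k V ⊗[k] (TensorAlgebra k V ⊗[k] TensorAlgebra k V) →ₗ[k] _) ((comulₗ k Γ V).lTensor _ t) := by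
      intro t
      induction t with
      | zero => simp
      | add a b ha hb => simp only [map_add, ha, hb]
      | tmul x y => simp [L_tmul, comulₗ_ι_mul, LinearMap.sum_apply]
    rw [hr, hl, ← hx]
    generalize (comulₗ k Γ V).rTensor _ (comulₗ k Γ V x) = t
    induction t with
    | zero => simp
    | add a b ha hb => simp only [map_add, ha, hb]
    | tmul t z =>
    induction t with
    | zero => simp
    | add a b ha hb => simp only [map_add, TensorProduct.add_tmul, ha, hb]
    | tmul x y =>
      simp only [LinearMap.add_apply, LinearMap.sum_apply, LinearMap.rTensor_tmul, L_tmul,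
        TensorProduct.map_tmul, map_add, map_sum, TensorProduct.add_tmul, TensorProduct.sum_tmul,
        TensorProduct.assoc_tmul, LinearMap.mulLeft_apply, TensorProduct.tmul_add,
        TensorProduct.tmul_sum, Finset.sum_add_distrib, add_assoc]
      congr 2
      refine Finset.sum_congr rfl fun g _ => ?_
      rw [Finset.sum_eq_single g]
      · rw [proj_proj_self]
      · intro b _ hb; rw [proj_proj_of_ne _ _ _ hb]; simp
      · simp


theorem counit_ι_mul (v : V) (x : TensorAlgebra k V) :
    TensorAlgebra.algebraMapInv (ι k v * x) = (0 : k) := by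
  simp [TensorAlgebra.algebraMapInv]

theorem counit_act (g : Γ) (x : TensorAlgebra k V) :
    (TensorAlgebra.algebraMapInv (act k g x) : k) = TensorAlgebra.algebraMapInv x := by
  induction x using left_induction with
  | one => simp [act_one]
  | smul r x hx => simp [hx]
  | add x y hx hy => simp [hx, hy]
  | mul v x hx => rw [act_mul, act_ι, counit_ι_mul, counit_ι_mul]

/-- The tensor algebra as a bialgebra in Yetter-Drinfeld modules, elements of `V` primitive. -/
instance : BraidedBialgebra k Γ (TensorAlgebra k V) where
  bcomul := comulₗ k Γ V
  bcounit := TensorAlgebra.algebraMapInv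
  bcomul_one := comulₗ_one
  bcomul_mul := comulₗ_mul
  bcomul_act := comulₗ_act
  bcomul_proj := comulₗ_proj
  bcounit_act := counit_act
  bcounit_proj g x hg := by
    induction x using left_induction with
    | one => rw [BraidedTensor.proj_one_of_ne hg, map_zero]
    | smul r x hx => simp [hx]
    | add x y hx hy => simp [hx, hy]
    | mul v x hx =>
      rw [proj_mul, map_sum]
      exact Finset.sum_eq_zero fun a _ => by rw [proj_ι, counit_ι_mul]
  bcoassoc := comulₗ_coassoc
  rTensor_bcounit_bcomul x := by
    induction x using left_induction with
    | one => simp [comulₗ_one]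
    | smul r x hx => rw [map_smul, map_smul, hx, TensorProduct.tmul_smul]
    | add x y hx hy => rw [map_add, map_add, hx, hy, TensorProduct.tmul_add]
    | mul v x hx =>
      have : ∀ t, (TensorAlgebra.algebraMapInv (R := k) (M := V)).toLinearMap.rTensor _ (L Γ v t) =
        (LinearMap.mulLeft k (ι k v)).lTensor k
          ((TensorAlgebra.algebraMapInv (R := k) (M := V)).toLinearMap.rTensor _ t) := by
        intro t
        induction t with
        | zero => simp
        | add a b ha hb => simp only [map_add, ha, hb]
        | tmul x y =>
          rw [L_tmul, map_add, map_sum]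
          simp only [LinearMap.rTensor_tmul, AlgHom.toLinearMap_apply, counit_ι_mul, counit_act,
            TensorProduct.zero_tmul, zero_add, ← TensorProduct.tmul_sum, ← Finset.sum_mul,
            ← map_sum, sum_proj, LinearMap.lTensor_tmul, LinearMap.mulLeft_apply]
      rw [comulₗ_ι_mul, this, hx]
      rfl
  lTensor_bcounit_bcomul x := by
    induction x using left_induction with
    | one => simp [comulₗ_one]
    | smul r x hx => rw [map_smul, map_smul, hx, TensorProduct.smul_tmul']
    | add x y hx hy => rw [map_add, map_add, hx, hy, TensorProduct.add_tmul]
    | mul v x hx =>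
      have : ∀ t, (TensorAlgebra.algebraMapInv (R := k) (M := V)).toLinearMap.lTensor _ (L Γ v t) =
        (LinearMap.mulLeft k (ι k v)).rTensor k
          ((TensorAlgebra.algebraMapInv (R := k) (M := V)).toLinearMap.lTensor _ t) := by
        intro t
        induction t with
        | zero => simp
        | add a b ha hb => simp only [map_add, ha, hb]
        | tmul x y =>
          rw [L_tmul, map_add, map_sum]
          simp only [LinearMap.rTensor_tmul, AlgHom.toLinearMap_apply, counit_ι_mul,
            TensorProduct.tmul_zero, add_zero, Finset.sum_const_zero, LinearMap.lTensor_tmul,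
            LinearMap.mulLeft_apply]
      rw [comulₗ_ι_mul, this, hx]
      rfl

end BraidedTensorAlgebra
end TensorAlg

section Quotient
variable {k Γ A : Type*} [Field k] [CommGroup Γ] [Fintype Γ] [Ring A] [Algebra k A]
  [BraidedBialgebra k Γ A]

variable (k Γ) in
/-- `J` is a two-sided ideal, a Yetter-Drinfeld submodule, and a coideal:
`Δ J ⊆ J ⊗ A + A ⊗ J` and `ε J = 0`. -/
structure IsBraidedBiideal (J : Ideal A) : Prop where
  isTwoSided : J.IsTwoSided
  act_mem : ∀ (g : Γ), ∀ x ∈ J, act k g x ∈ J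
  proj_mem : ∀ (g : Γ), ∀ x ∈ J, proj k g x ∈ J
  bcomul_mem : ∀ x ∈ J, bcomul k Γ x ∈
    LinearMap.range ((J.restrictScalars k).subtype.rTensor A) ⊔
      LinearMap.range ((J.restrictScalars k).subtype.lTensor A)
  bcounit_eq_zero : ∀ x ∈ J, bcounit k Γ x = 0

namespace IsBraidedBiideal

theorem of_sSup {S : Set (Ideal A)} (hS : ∀ J ∈ S, IsBraidedBiideal k Γ J) :
    IsBraidedBiideal k Γ (sSup S) := by
  have key : ∀ {P : A → Prop}, P 0 → (∀ x y, P x → P y → P (x + y)) →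
      (∀ J ∈ S, ∀ x ∈ J, P x) → ∀ x ∈ sSup S, P x := by
    intro P h0 hadd h x hx
    rw [sSup_eq_iSup'] at hx
    exact Submodule.iSup_induction _ (motive := P) hx (fun J => h J J.2) h0 hadd
  constructor
  · refine ⟨fun {a} b ha => ?_⟩
    refine key (P := fun a => a * b ∈ sSup S) (by simp) (fun x y hx hy => ?_) (fun J hJ x hx => ?_) a ha
    · rw [add_mul]; exact add_mem hx hy
    · exact le_sSup hJ ((hS J hJ).isTwoSided.mul_mem_of_left b hx)
  · intro g
    refine key (by simp) (fun x y hx hy => ?_) (fun J hJ x hx => ?_)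
    · rw [map_add]; exact add_mem hx hy
    · exact le_sSup hJ ((hS J hJ).act_mem g x hx)
  · intro g
    refine key (by simp) (fun x y hx hy => ?_) (fun J hJ x hx => ?_)
    · rw [map_add]; exact add_mem hx hy
    · exact le_sSup hJ ((hS J hJ).proj_mem g x hx)
  · refine key (by simp) (fun x y hx hy => ?_) (fun J hJ x hx => ?_)
    · rw [map_add]; exact add_mem hx hy
    · refine SetLike.le_def.mp (sup_le_sup ?_ ?_) ((hS J hJ).bcomul_mem x hx)
      · rintro _ ⟨t, rfl⟩
        refine ⟨(Submodule.inclusion (p := J.restrictScalars k) (p' := (sSup S).restrictScalars k)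
          (fun y hy => le_sSup hJ hy)).rTensor A t, ?_⟩
        rw [← LinearMap.rTensor_comp_apply]; rfl
      · rintro _ ⟨t, rfl⟩
        refine ⟨(Submodule.inclusion (p := J.restrictScalars k) (p' := (sSup S).restrictScalars k)
          (fun y hy => le_sSup hJ hy)).lTensor A t, ?_⟩
        rw [← LinearMap.lTensor_comp_apply]; rfl
  · refine key (by simp) (fun x y hx hy => ?_) (fun J hJ x hx => ?_)
    · rw [map_add, hx, hy, add_zero]
    · exact (hS J hJ).bcounit_eq_zero x hx

variable (k) in
/-- Descending a linear map to the quotient by an ideal. -/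
def liftLinear (J : Ideal A) [J.IsTwoSided] {M : Type*} [AddCommGroup M] [Module k M] (f : A →ₗ[k] M)
    (h : ∀ x ∈ J, f x = 0) : A ⧸ J →ₗ[k] M :=
  (J.restrictScalars k).liftQ f h ∘ₗ (Submodule.Quotient.restrictScalarsEquiv k J).symm.toLinearMap

theorem liftLinear_mk (J : Ideal A) [J.IsTwoSided] {M : Type*} [AddCommGroup M] [Module k M] (f : A →ₗ[k] M)
    (h : ∀ x ∈ J, f x = 0) (x : A) : liftLinear k J f h (Ideal.Quotient.mkₐ k J x) = f x := rfl

theorem map_mulMap {A B : Type*} [Ring A] [Algebra k A] [Ring B] [Algebra k B] [YDAlgebra k Γ A]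
    [YDAlgebra k Γ B] (f : A →ₐ[k] B) (hact : ∀ (g : Γ) x, f (act k g x) = act k g (f x))
    (hproj : ∀ (g : Γ) x, f (proj k g x) = proj k g (f x)) (s t : A ⊗[k] A) :
    TensorProduct.map f.toLinearMap f.toLinearMap (BraidedTensor.mulMap k Γ A A s t) =
      BraidedTensor.mulMap k Γ B B (TensorProduct.map f.toLinearMap f.toLinearMap s)
        (TensorProduct.map f.toLinearMap f.toLinearMap t) := by
  induction s with
  | zero => simp
  | add a b ha hb => simp only [map_add, LinearMap.add_apply, ha, hb]
  | tmul x y =>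
  induction t with
  | zero => simp
  | add a b ha hb => simp only [map_add, ha, hb]
  | tmul x' y' => simp [BraidedTensor.mulMap_tmul, hact, hproj]

variable {J : Ideal A} [J.IsTwoSided]

theorem mk_surj : Function.Surjective (Ideal.Quotient.mkₐ k J) := Ideal.Quotient.mkₐ_surjective k J

theorem mk_eq_zero {x : A} (hx : x ∈ J) : Ideal.Quotient.mkₐ k J x = 0 :=
  Ideal.Quotient.eq_zero_iff_mem.mpr hx

theorem map_mk_bcomul (hJ : IsBraidedBiideal k Γ J) {x : A} (hx : x ∈ J) :
    TensorProduct.map (Ideal.Quotient.mkₐ k J).toLinearMap (Ideal.Quotient.mkₐ k J).toLinearMap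
      (bcomul k Γ x) = 0 := by
  have h0 : (Ideal.Quotient.mkₐ k J).toLinearMap ∘ₗ (J.restrictScalars k).subtype = 0 := by
    ext y; exact mk_eq_zero (k := k) y.2
  obtain ⟨_, ⟨a, rfl⟩, _, ⟨b, rfl⟩, h⟩ := Submodule.mem_sup.mp (hJ.bcomul_mem x hx)
  rw [← h, map_add]
  rw [← LinearMap.comp_apply, ← LinearMap.comp_apply (g := LinearMap.lTensor _ _),
    LinearMap.map_comp_rTensor, LinearMap.map_comp_lTensor, h0]
  simp

/-- The induced action on the quotient. -/
def actQ (hJ : IsBraidedBiideal k Γ J) (g : Γ) : A ⧸ J →ₗ[k] A ⧸ J :=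
  liftLinear k J ((Ideal.Quotient.mkₐ k J).toLinearMap ∘ₗ act k g)
    fun x hx => mk_eq_zero (k := k) (hJ.act_mem g x hx)

theorem actQ_mk (hJ : IsBraidedBiideal k Γ J) (g : Γ) (x : A) :
    actQ hJ g (Ideal.Quotient.mkₐ k J x) = Ideal.Quotient.mkₐ k J (act k g x) := rfl

/-- The induced grading on the quotient. -/
def projQ (hJ : IsBraidedBiideal k Γ J) (g : Γ) : A ⧸ J →ₗ[k] A ⧸ J :=
  liftLinear k J ((Ideal.Quotient.mkₐ k J).toLinearMap ∘ₗ proj k g)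
    fun x hx => mk_eq_zero (k := k) (hJ.proj_mem g x hx)

theorem projQ_mk (hJ : IsBraidedBiideal k Γ J) (g : Γ) (x : A) :
    projQ hJ g (Ideal.Quotient.mkₐ k J x) = Ideal.Quotient.mkₐ k J (proj k g x) := rfl

/-- The quotient as an algebra in Yetter-Drinfeld modules. -/
@[reducible] def ydAlgebra (hJ : IsBraidedBiideal k Γ J) : YDAlgebra k Γ (A ⧸ J) where
  act :=
    { toFun g := actQ hJ g
      map_one' := by
        refine LinearMap.ext fun x => ?_
        obtain ⟨x, rfl⟩ := mk_surj (k := k) x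
        rw [actQ_mk, map_one]; rfl
      map_mul' g h := by
        refine LinearMap.ext fun x => ?_
        obtain ⟨x, rfl⟩ := mk_surj (k := k) x
        rw [Module.End.mul_apply, actQ_mk, actQ_mk, actQ_mk, map_mul]; rfl }
  proj g := projQ hJ g
  proj_proj_of_ne g h x hgh := by
    obtain ⟨x, rfl⟩ := mk_surj (k := k) x
    rw [projQ_mk, projQ_mk, proj_proj_of_ne _ _ _ hgh, map_zero]
  sum_proj x := by
    obtain ⟨x, rfl⟩ := mk_surj (k := k) x
    simp only [projQ_mk]
    rw [← map_sum, sum_proj]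
  proj_act g h x := by
    obtain ⟨x, rfl⟩ := mk_surj (k := k) x
    change projQ hJ g (actQ hJ h _) = actQ hJ h _
    rw [projQ_mk, actQ_mk, actQ_mk, projQ_mk, proj_act]
  act_one g := by
    change actQ hJ g 1 = 1
    rw [← map_one (Ideal.Quotient.mkₐ k J), actQ_mk, act_one]
  act_mul g x y := by
    obtain ⟨x, rfl⟩ := mk_surj (k := k) x
    obtain ⟨y, rfl⟩ := mk_surj (k := k) y
    change actQ hJ g _ = actQ hJ g _ * actQ hJ g _
    rw [← map_mul, actQ_mk, actQ_mk, actQ_mk, act_mul, map_mul]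
  proj_one := by
    rw [← map_one (Ideal.Quotient.mkₐ k J), projQ_mk, proj_one]
  proj_mul g x y := by
    obtain ⟨x, rfl⟩ := mk_surj (k := k) x
    obtain ⟨y, rfl⟩ := mk_surj (k := k) y
    rw [← map_mul, projQ_mk, proj_mul, map_sum]
    simp only [projQ_mk, map_mul]

/-- The induced comultiplication on the quotient. -/
def comulQ (hJ : IsBraidedBiideal k Γ J) : A ⧸ J →ₗ[k] (A ⧸ J) ⊗[k] (A ⧸ J) :=
  liftLinear k J (TensorProduct.map (Ideal.Quotient.mkₐ k J).toLinearMap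
    (Ideal.Quotient.mkₐ k J).toLinearMap ∘ₗ bcomul k Γ) fun _ hx => map_mk_bcomul hJ hx

theorem comulQ_mk (hJ : IsBraidedBiideal k Γ J) (x : A) :
    comulQ hJ (Ideal.Quotient.mkₐ k J x) = TensorProduct.map (Ideal.Quotient.mkₐ k J).toLinearMap
    (Ideal.Quotient.mkₐ k J).toLinearMap (bcomul k Γ x) := rfl

/-- The induced counit on the quotient. -/
def counitQ (hJ : IsBraidedBiideal k Γ J) : A ⧸ J →ₐ[k] k :=
  Ideal.Quotient.liftₐ J (bcounit k Γ) hJ.bcounit_eq_zero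

theorem counitQ_mk (hJ : IsBraidedBiideal k Γ J) (x : A) :
    counitQ hJ (Ideal.Quotient.mkₐ k J x) = bcounit k Γ x := rfl

/-- The quotient as a bialgebra in Yetter-Drinfeld modules. -/
@[reducible] def braidedBialgebra (hJ : IsBraidedBiideal k Γ J) :
    BraidedBialgebra k Γ (A ⧸ J) where
  __ := ydAlgebra hJ
  bcomul := comulQ hJ
  bcounit := counitQ hJ
  bcomul_one := by
    rw [← map_one (Ideal.Quotient.mkₐ k J), comulQ_mk, bcomul_one, TensorProduct.map_tmul]; rfl
  bcomul_mul x y := by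
    obtain ⟨x, rfl⟩ := mk_surj (k := k) x
    obtain ⟨y, rfl⟩ := mk_surj (k := k) y
    let _ := ydAlgebra hJ
    rw [← map_mul, comulQ_mk, bcomul_mul,
      map_mulMap _ (fun g x => (actQ_mk hJ g x).symm) (fun g x => (projQ_mk hJ g x).symm)]; rfl
  bcomul_act g x := by
    obtain ⟨x, rfl⟩ := mk_surj (k := k) x
    change comulQ hJ (actQ hJ g _) = TensorProduct.map (actQ hJ g) (actQ hJ g) (comulQ hJ _)
    rw [actQ_mk, comulQ_mk, comulQ_mk, bcomul_act, TensorProduct.map_map, TensorProduct.map_map]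
    rfl
  bcomul_proj g x := by
    obtain ⟨x, rfl⟩ := mk_surj (k := k) x
    change comulQ hJ (projQ hJ g _) =
      ∑ a, TensorProduct.map (projQ hJ a) (projQ hJ (a⁻¹ * g)) (comulQ hJ _)
    rw [projQ_mk, comulQ_mk, comulQ_mk, bcomul_proj, map_sum]
    refine Finset.sum_congr rfl fun a _ => ?_
    rw [TensorProduct.map_map, TensorProduct.map_map]
    rfl
  bcounit_act g x := by
    obtain ⟨x, rfl⟩ := mk_surj (k := k) x
    change counitQ hJ (actQ hJ g _) = counitQ hJ _
    rw [actQ_mk, counitQ_mk, counitQ_mk, bcounit_act]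
  bcounit_proj g x hg := by
    obtain ⟨x, rfl⟩ := mk_surj (k := k) x
    change counitQ hJ (projQ hJ g _) = 0
    rw [projQ_mk, counitQ_mk, bcounit_proj _ _ hg]
  bcoassoc x := by
    obtain ⟨x, rfl⟩ := mk_surj (k := k) x
    set π := (Ideal.Quotient.mkₐ k J).toLinearMap
    have h1 : ∀ t, (comulQ hJ).rTensor _ (TensorProduct.map π π t) =
        TensorProduct.map (TensorProduct.map π π) π ((bcomul k Γ).rTensor _ t) := by
      intro t
      induction t with
      | zero => simp
      | add a b ha hb => simp only [map_add, ha, hb]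
      | tmul x y => rfl
    have h2 : ∀ t, (comulQ hJ).lTensor _ (TensorProduct.map π π t) =
        TensorProduct.map π (TensorProduct.map π π) ((bcomul k Γ).lTensor _ t) := by
      intro t
      induction t with
      | zero => simp
      | add a b ha hb => simp only [map_add, ha, hb]
      | tmul x y => rfl
    rw [comulQ_mk, h1, h2, ← bcoassoc]
    exact (TensorProduct.map_map_assoc π π π _).symm
  rTensor_bcounit_bcomul x := by
    obtain ⟨x, rfl⟩ := mk_surj (k := k) x
    have h : ∀ t, (counitQ hJ).toLinearMap.rTensor _ (TensorProduct.map
        (Ideal.Quotient.mkₐ k J).toLinearMap (Ideal.Quotient.mkₐ k J).toLinearMap t) =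
        (Ideal.Quotient.mkₐ k J).toLinearMap.lTensor k
          ((bcounit k Γ).toLinearMap.rTensor _ t) := by
      intro t
      induction t with
      | zero => simp
      | add a b ha hb => simp only [map_add, ha, hb]
      | tmul x y => rfl
    rw [comulQ_mk, h, rTensor_bcounit_bcomul]; rfl
  lTensor_bcounit_bcomul x := by
    obtain ⟨x, rfl⟩ := mk_surj (k := k) x
    have h : ∀ t, (counitQ hJ).toLinearMap.lTensor _ (TensorProduct.map
        (Ideal.Quotient.mkₐ k J).toLinearMap (Ideal.Quotient.mkₐ k J).toLinearMap t) =
        (Ideal.Quotient.mkₐ k J).toLinearMap.rTensor k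
          ((bcounit k Γ).toLinearMap.lTensor _ t) := by
      intro t
      induction t with
      | zero => simp
      | add a b ha hb => simp only [map_add, ha, hb]
      | tmul x y => rfl
    rw [comulQ_mk, h, lTensor_bcounit_bcomul]; rfl

end IsBraidedBiideal
end Quotient

section Nichols
variable (k Γ V : Type*) [Field k] [CommGroup Γ] [Fintype Γ]
  [AddCommGroup V] [Module k V] [YetterDrinfeld k Γ V]

/-- The ideals of `T(V)` admitted in the construction of the Nichols algebra: Yetter-Drinfeld
submodules that are two-sided ideals and coideals, homogeneous for the `ℕ`-grading of `T(V)`, with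
vanishing components in degrees `0` and `1` (i.e. generated by homogeneous elements of degree at
least `2`). -/
structure IsNicholsIdeal (J : Ideal (TensorAlgebra k V)) : Prop
    extends IsBraidedBiideal k Γ J where
  isHomogeneous : J.IsHomogeneous
    (fun n : ℕ => LinearMap.range (TensorAlgebra.ι k : V →ₗ[k] TensorAlgebra k V) ^ n)
  decompose_eq_zero : ∀ x ∈ J, ∀ n < 2, (DirectSum.decompose
    (fun n : ℕ => LinearMap.range (TensorAlgebra.ι k : V →ₗ[k] TensorAlgebra k V) ^ n) x n :
      TensorAlgebra k V) = 0

/-- The sum of all admitted ideals. -/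
def nicholsIdeal : Ideal (TensorAlgebra k V) := sSup {J | IsNicholsIdeal k Γ V J}

theorem nicholsIdeal_isBraidedBiideal : IsBraidedBiideal k Γ (nicholsIdeal k Γ V) :=
  IsBraidedBiideal.of_sSup fun _ hJ => hJ.toIsBraidedBiideal

instance : (nicholsIdeal k Γ V).IsTwoSided := (nicholsIdeal_isBraidedBiideal k Γ V).isTwoSided

/-- The Nichols algebra `𝓑(V)`: the quotient of the tensor algebra by the largest admitted ideal. -/
abbrev NicholsAlgebra : Type _ := TensorAlgebra k V ⧸ nicholsIdeal k Γ V

/-- The Nichols algebra with the structure induced from the tensor algebra. -/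
instance : BraidedBialgebra k Γ (NicholsAlgebra k Γ V) :=
  (nicholsIdeal_isBraidedBiideal k Γ V).braidedBialgebra

end Nichols

section DualBialgebra
variable {k H : Type*} [Field k] [Ring H] [Bialgebra k H] [FiniteDimensional k H]

variable (k H) in
/-- The linear dual `H^*` of a finite-dimensional bialgebra. The multiplication is convolution
`(f * g)(x) = f(x₍₁₎) g(x₍₂₎)` with unit `ε`; the comultiplication is the transpose of the
multiplication, `(Δ f)(x ⊗ y) = f (x y)` under `H^* ⊗ H^* ≃ (H ⊗ H)^*` (see `ev_comul`), with counit
`f ↦ f 1`. -/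
def DualBialgebra : Type _ := WithConv (H →ₗ[k] k)

namespace DualBialgebra

instance : Ring (DualBialgebra k H) := inferInstanceAs (Ring (WithConv (H →ₗ[k] k)))
instance : Algebra k (DualBialgebra k H) := inferInstanceAs (Algebra k (WithConv (H →ₗ[k] k)))

variable (k H) in
/-- The identification with the linear dual. -/
def toDual : DualBialgebra k H ≃ₗ[k] Module.Dual k H where
  toFun f := WithConv.ofConv f
  invFun f := WithConv.toConv f
  map_add' _ _ := rfl
  map_smul' _ _ := rfl

instance : CoeFun (DualBialgebra k H) fun _ => H → k := ⟨fun f => toDual k H f⟩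


instance : CoalgebraStruct k (DualBialgebra k H) where
  comul := TensorProduct.map (toDual k H).symm.toLinearMap
      (toDual k H).symm.toLinearMap ∘ₗ
    (TensorProduct.dualDistribEquiv k H H).symm.toLinearMap ∘ₗ
    (LinearMap.mul' k H).dualMap ∘ₗ (toDual k H).toLinearMap
  counit := LinearMap.applyₗ (1 : H) ∘ₗ (toDual k H).toLinearMap

theorem mul_apply' (f g : DualBialgebra k H) (x : H) : (f * g) x =
    LinearMap.mul' k k (TensorProduct.map (toDual k H f) (toDual k H g)
      (Coalgebra.comul (R := k) x)) := rfl

/-- The pairing `(f ⊗ g)(x ⊗ y) = f x * g y`. -/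
def ev : DualBialgebra k H ⊗[k] DualBialgebra k H →ₗ[k] Module.Dual k (H ⊗[k] H) :=
  TensorProduct.dualDistrib k H H ∘ₗ
    TensorProduct.map (toDual k H).toLinearMap
      (toDual k H).toLinearMap

theorem ev_tmul (f g : DualBialgebra k H) (x y : H) : ev (f ⊗ₜ g) (x ⊗ₜ y) = f x * g y := rfl

theorem ev_comul (f : DualBialgebra k H) (x y : H) :
    ev (Coalgebra.comul (R := k) f) (x ⊗ₜ y) = f (x * y) := by
  simp only [ev, Coalgebra.comul, LinearMap.comp_apply, TensorProduct.map_map]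
  have h : ((toDual k H).toLinearMap ∘ₗ
    (toDual k H).symm.toLinearMap) = LinearMap.id := by
    ext; rfl
  rw [h, TensorProduct.map_id, LinearMap.id_apply]
  change (TensorProduct.dualDistribEquiv k H H ((TensorProduct.dualDistribEquiv k H H).symm _)) _ = _
  rw [LinearEquiv.apply_symm_apply]
  rfl

theorem ev_injective : Function.Injective (ev (k := k) (H := H)) :=
  (TensorProduct.dualDistribEquiv k H H).injective.comp
    (TensorProduct.congr (toDual k H)
      (toDual k H)).injective

theorem ext_ev {s t : DualBialgebra k H ⊗[k] DualBialgebra k H}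
    (h : ∀ x y : H, ev s (x ⊗ₜ y) = ev t (x ⊗ₜ y)) : s = t :=
  ev_injective (TensorProduct.ext' h)

/-- The pairing of triple tensor powers. -/
def evv : DualBialgebra k H ⊗[k] (DualBialgebra k H ⊗[k] DualBialgebra k H) →ₗ[k]
    Module.Dual k (H ⊗[k] (H ⊗[k] H)) :=
  TensorProduct.dualDistrib k H (H ⊗[k] H) ∘ₗ
    TensorProduct.map (toDual k H).toLinearMap ev

theorem evv_tmul (f : DualBialgebra k H) (s : DualBialgebra k H ⊗[k] DualBialgebra k H)
    (x : H) (t : H ⊗[k] H) : evv (f ⊗ₜ s) (x ⊗ₜ t) = f x * ev s t := rfl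

theorem evv_injective : Function.Injective (evv (k := k) (H := H)) := by
  refine (TensorProduct.dualDistribEquiv k H (H ⊗[k] H)).injective.comp ?_
  exact TensorProduct.map_injective_of_flat_flat _ _
    (toDual k H).injective ev_injective

theorem evv_lTensor (t : DualBialgebra k H ⊗[k] DualBialgebra k H) (x y z : H) :
    evv ((Coalgebra.comul (R := k)).lTensor _ t) (x ⊗ₜ (y ⊗ₜ z)) = ev t (x ⊗ₜ (y * z)) := by
  induction t with
  | zero => simp
  | add a b ha hb => simp only [map_add, LinearMap.add_apply, ha, hb]
  | tmul f g => rw [LinearMap.lTensor_tmul, evv_tmul, ev_comul, ev_tmul]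

theorem evv_rTensor (t : DualBialgebra k H ⊗[k] DualBialgebra k H) (x y z : H) :
    evv (TensorProduct.assoc k _ _ _ ((Coalgebra.comul (R := k)).rTensor _ t)) (x ⊗ₜ (y ⊗ₜ z)) =
      ev t ((x * y) ⊗ₜ z) := by
  induction t with
  | zero => simp
  | add a b ha hb => simp only [map_add, LinearMap.add_apply, ha, hb]
  | tmul f g =>
    rw [LinearMap.rTensor_tmul, ev_tmul, ← ev_comul]
    induction Coalgebra.comul (R := k) f with
    | zero => simp
    | add a b ha hb =>
      rw [TensorProduct.add_tmul, map_add, map_add, LinearMap.add_apply, ha, hb, map_add,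
        LinearMap.add_apply, add_mul]
    | tmul f f' => rw [TensorProduct.assoc_tmul, evv_tmul, ev_tmul, ev_tmul, mul_assoc]

instance : Coalgebra k (DualBialgebra k H) where
  coassoc := by
    refine LinearMap.ext fun f => evv_injective (TensorProduct.ext' fun x t => ?_)
    induction t with
    | zero => simp
    | add a b ha hb => rw [TensorProduct.tmul_add, map_add, map_add, ha, hb]
    | tmul y z =>
      refine (evv_rTensor _ _ _ _).trans ((evv_lTensor _ _ _ _).trans ?_).symm
      rw [ev_comul, ev_comul, mul_assoc]
  rTensor_counit_comp_comul := by
    refine LinearMap.ext fun f => (TensorProduct.lid k _).injective ((toDual k H).injective (LinearMap.ext fun x => ?_))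
    have h : ∀ t : DualBialgebra k H ⊗[k] DualBialgebra k H,
        toDual k H (TensorProduct.lid k _ ((Coalgebra.counit (R := k)).rTensor _ t)) x =
          ev t (1 ⊗ₜ x) := by
      intro t
      induction t with
      | zero => simp
      | add a b ha hb => simp only [map_add, LinearMap.add_apply, ha, hb]
      | tmul f g => rfl
    refine (h _).trans ?_
    rw [ev_comul, one_mul]
    simp
  lTensor_counit_comp_comul := by
    refine LinearMap.ext fun f => (TensorProduct.rid k _).injective ((toDual k H).injective (LinearMap.ext fun x => ?_))
    have h : ∀ t : DualBialgebra k H ⊗[k] DualBialgebra k H,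
        toDual k H (TensorProduct.rid k _ ((Coalgebra.counit (R := k)).lTensor _ t)) x =
          ev t (x ⊗ₜ 1) := by
      intro t
      induction t with
      | zero => simp
      | add a b ha hb => simp only [map_add, LinearMap.add_apply, ha, hb]
      | tmul f g => exact mul_comm _ _
    refine (h _).trans ?_
    rw [ev_comul, mul_one]
    simp

theorem ev_mul (s t : DualBialgebra k H ⊗[k] DualBialgebra k H) (x y : H) :
    ev (s * t) (x ⊗ₜ y) = LinearMap.mul' k k (TensorProduct.map (ev s) (ev t)
      (TensorProduct.tensorTensorTensorComm k H H H H
        (Coalgebra.comul (R := k) x ⊗ₜ Coalgebra.comul (R := k) y))) := by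
  induction s with
  | zero => simp
  | add a b ha hb =>
    rw [add_mul, map_add, LinearMap.add_apply, ha, hb, map_add, TensorProduct.map_add_left,
      LinearMap.add_apply, map_add]
  | tmul f f' =>
  induction t with
  | zero => simp
  | add a b ha hb =>
    rw [mul_add, map_add, LinearMap.add_apply, ha, hb, map_add, TensorProduct.map_add_right,
      LinearMap.add_apply, map_add]
  | tmul g g' =>
    rw [Algebra.TensorProduct.tmul_mul_tmul, ev_tmul, mul_apply',
      mul_apply']
    induction Coalgebra.comul (R := k) x with
    | zero => simp
    | add a b ha hb => simp only [map_add, add_mul, ha, hb, TensorProduct.add_tmul]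
    | tmul a b =>
    induction Coalgebra.comul (R := k) y with
    | zero => simp
    | add a b ha hb => simp only [map_add, mul_add, ha, hb, TensorProduct.tmul_add]
    | tmul c d =>
      rw [TensorProduct.tensorTensorTensorComm_tmul, TensorProduct.map_tmul,
        TensorProduct.map_tmul, TensorProduct.map_tmul, ev_tmul, ev_tmul, LinearMap.mul'_apply,
        LinearMap.mul'_apply, LinearMap.mul'_apply]
      exact mul_mul_mul_comm _ _ _ _

theorem ev_comul_eq (f : DualBialgebra k H) :
    ev (Coalgebra.comul (R := k) f) = toDual k H f ∘ₗ LinearMap.mul' k H :=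
  TensorProduct.ext' fun x y => ev_comul f x y

instance : Bialgebra k (DualBialgebra k H) :=
  Bialgebra.mk' k _
    (by
      change (Coalgebra.counit (R := k) (1 : H) : k) = 1
      simp)
    (by
      intro f g
      change (f * g) (1 : H) = f 1 * g 1
      rw [mul_apply', Bialgebra.comul_one, Algebra.TensorProduct.one_def]; rfl)
    (by
      refine ext_ev fun x y => ?_
      rw [ev_comul, Algebra.TensorProduct.one_def, ev_tmul]
      change (Coalgebra.counit (R := k) (x * y) : k) =
        Coalgebra.counit (R := k) x * Coalgebra.counit (R := k) y
      simp)
    (by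
      intro f g
      refine ext_ev fun x y => ?_
      rw [ev_comul, ev_mul, ev_comul_eq, ev_comul_eq, mul_apply', Bialgebra.comul_mul]
      induction Coalgebra.comul (R := k) x with
      | zero => simp
      | add a b ha hb => simp only [map_add, add_mul, ha, hb, TensorProduct.add_tmul]
      | tmul a b =>
      induction Coalgebra.comul (R := k) y with
      | zero => simp
      | add a b ha hb => simp only [map_add, mul_add, ha, hb, TensorProduct.tmul_add]
      | tmul c d =>
        rw [Algebra.TensorProduct.tmul_mul_tmul, TensorProduct.tensorTensorTensorComm_tmul]; rfl)

end DualBialgebra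
end DualBialgebra

/-- The character group of a finite group is finite. -/
instance characterGroupFintype (k Γ : Type*) [Field k] [CommGroup Γ] [Fintype Γ] :
    Fintype (Γ →* kˣ) := Fintype.ofFinite _

end

/-! A Hopf algebra isomorphism onto a dual amounts to a nondegenerate Hopf pairing: a bilinear form
for which the product on each side is transpose to the coproduct on the other. The pairing is built
on `W` and `V`, extended to tensor algebras, pushed down to Nichols algebras, and extended to
bosonizations.

On `W × V` take the form making `w_i` and `v_i` dual bases. The swap of degrees and characters
between `w_i` and `v_i` says exactly that the action of `γ` on one side is adjoint to weighting the
graded components on the other by the values of `γ`, and conversely. This compatibility survives the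
extension to `T(W) × T(V)` and makes the two braidings adjoint (`tensorPairing_braidMiddle`). A form
that is multiplicative on the left by construction is therefore multiplicative on the right as well
(`tensorForm_mul_right`).

The Nichols ideal is the radical of such a pairing (`nicholsIdeal_eq_leftRadical`). The radical of a
Hopf pairing is a braided biideal. It is homogeneous because different tensor degrees are
orthogonal, and it has no part in degrees below two because the form is nondegenerate there.
Conversely, an admitted ideal `I` pairs to zero with `V`, having no part of degree one. Since `Δ I ⊆
I ⊗ T + T ⊗ I`, it pairs to zero with all products. By symmetry the same holds on the other side, so
the form induced on the two Nichols algebras is nondegenerate on both sides.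

Finally `⟨a # χ, x # g⟩ = ⟨a, x⟩ χ(g)`. The twist by the action in the smash product is transpose to
the twist by the coaction in the smash coproduct, so this is an ordinary Hopf pairing
(`bosonizationForm_mul_left`). It is nondegenerate because distinct characters are independent and,
over an algebraically closed field of characteristic zero, characters separate points. As `𝓑(V) #
k[Γ]` is finite-dimensional, the pairing is perfect. A bialgebra isomorphism between Hopf algebras
respects antipodes automatically, so a bialgebra equivalence is enough. -/

noncomputable section
open YetterDrinfeld YDAlgebra BraidedBialgebra

/-! ### Bilinear forms on tensor products, and characters against convolution -/

section TensorPairing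
variable {k A A' B B' : Type*} [Field k] [AddCommGroup A] [Module k A] [AddCommGroup A']
  [Module k A'] [AddCommGroup B] [Module k B] [AddCommGroup B'] [Module k B']

/-- The tensor product of two bilinear forms: `⟨a ⊗ a', b ⊗ b'⟩ = ⟨a, b⟩ ⟨a', b'⟩`. -/
def tensorPairing (p : A →ₗ[k] B →ₗ[k] k) (q : A' →ₗ[k] B' →ₗ[k] k) :
    A ⊗[k] A' →ₗ[k] B ⊗[k] B' →ₗ[k] k :=
  TensorProduct.dualDistrib k B B' ∘ₗ TensorProduct.map p q

@[simp]
theorem tensorPairing_tmul (p : A →ₗ[k] B →ₗ[k] k) (q : A' →ₗ[k] B' →ₗ[k] k) (a a' b b') :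
    tensorPairing p q (a ⊗ₜ a') (b ⊗ₜ b') = p a b * q a' b' := rfl

/-- Makes the axioms of a Hopf pairing symmetric in the two sides, so that later results need proof
on one side only. -/
theorem tensorPairing_flip (p : A →ₗ[k] B →ₗ[k] k) (q : A' →ₗ[k] B' →ₗ[k] k) :
    tensorPairing p.flip q.flip = (tensorPairing p q).flip := by
  ext; rfl

end TensorPairing

/-- A character turns convolution on the group into multiplication. The inner sum has the shape in
which products and coproducts of graded objects split into components. -/
theorem sum_mul_sum_inv_mul {k G : Type*} [Field k] [CommGroup G] [Fintype G] (φ : G →* kˣ)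
    (F H : G → k) : ∑ g, (φ g : k) * ∑ a, F a * H (a⁻¹ * g) =
      (∑ a, (φ a : k) * F a) * ∑ b, (φ b : k) * H b := by
  rw [Finset.sum_mul]
  simp only [Finset.mul_sum]
  rw [Finset.sum_comm]
  refine Finset.sum_congr rfl fun a _ => ?_
  refine (Fintype.sum_equiv (Equiv.mulLeft a) _ _ fun b => ?_).symm
  simp
  ring

/-! ### The braiding of a tensor square, and braided Hopf pairings -/

section BraidingMap
variable {k G A : Type*} [Field k] [CommGroup G] [Fintype G] [Ring A] [Algebra k A]
  [YDAlgebra k G A]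

variable (k G A) in
/-- The map `(x ⊗ y) ⊗ (x' ⊗ y') ↦ ∑ g, (x ⊗ g • x') ⊗ (y_g ⊗ y')`. -/
def braidMiddle : (A ⊗[k] A) ⊗[k] (A ⊗[k] A) →ₗ[k] (A ⊗[k] A) ⊗[k] (A ⊗[k] A) :=
  (∑ g : G, TensorProduct.map ((act k g).lTensor A) ((proj k g).rTensor A)) ∘ₗ
    (TensorProduct.tensorTensorTensorComm k A A A A).toLinearMap

theorem braidMiddle_tmul (x y x' y' : A) : braidMiddle k G A ((x ⊗ₜ y) ⊗ₜ (x' ⊗ₜ y')) =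
    ∑ g : G, (x ⊗ₜ act k g x') ⊗ₜ (proj k g y ⊗ₜ y') := by
  simp [braidMiddle]

/-- Splits the braided product into a braiding followed by two ordinary products, so that each
factor can be transposed separately under a pairing. -/
theorem mulMap_eq_braidMiddle (s t : A ⊗[k] A) : BraidedTensor.mulMap k G A A s t =
    TensorProduct.map (LinearMap.mul' k A) (LinearMap.mul' k A) (braidMiddle k G A (s ⊗ₜ t)) := by
  induction s with
  | zero => simp
  | add a b ha hb => simp only [map_add, LinearMap.add_apply, TensorProduct.add_tmul, ha, hb]
  | tmul x y =>
  induction t with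
  | zero => simp
  | add a b ha hb => simp only [map_add, TensorProduct.tmul_add, ha, hb]
  | tmul x' y' => simp [braidMiddle_tmul, BraidedTensor.mulMap_tmul]

end BraidingMap

/-- A Hopf pairing between braided bialgebras `A` over `k[G']` and `B` over `k[G]`, compatible with
the action and grading through the bicharacter `β : G' × G → kˣ`. -/
structure BraidedPairing {k G' G : Type*} [Field k] [CommGroup G'] [Fintype G'] [CommGroup G]
    [Fintype G] (β : G' →* G →* kˣ) (A B : Type*) [Ring A] [Algebra k A] [BraidedBialgebra k G' A]
    [Ring B] [Algebra k B] [BraidedBialgebra k G B] where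
  /-- the bilinear form -/
  form : A →ₗ[k] B →ₗ[k] k
  one_left : ∀ x, form 1 x = bcounit k G x
  one_right : ∀ a, form a 1 = bcounit k G' a
  mul_left : ∀ a b x, form (a * b) x = tensorPairing form form (a ⊗ₜ b) (bcomul k G x)
  mul_right : ∀ a x y, form a (x * y) = tensorPairing form form (bcomul k G' a) (x ⊗ₜ y)
  act_left : ∀ (χ : G') a x, form (act k χ a) x = ∑ g, (β χ g : k) * form a (proj k g x)
  act_right : ∀ (g : G) a x, form a (act k g x) = ∑ χ, (β χ g : k) * form (proj k χ a) x

/-- The flipped pairing. -/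
def BraidedPairing.flip {k G' G : Type*} [Field k] [CommGroup G'] [Fintype G'] [CommGroup G]
    [Fintype G] {β : G' →* G →* kˣ} {A B : Type*} [Ring A] [Algebra k A] [BraidedBialgebra k G' A]
    [Ring B] [Algebra k B] [BraidedBialgebra k G B] (P : BraidedPairing β A B) :
    BraidedPairing β.flip B A where
  form := P.form.flip
  one_left := P.one_right
  one_right := P.one_left
  mul_left x y a := by rw [tensorPairing_flip]; exact P.mul_right a x y
  mul_right x a b := by rw [tensorPairing_flip]; exact P.mul_left a b x
  act_left g x a := P.act_right g a x
  act_right χ x a := P.act_left χ a x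

/-! ### Extending a form on `W × V` to a Hopf pairing of tensor algebras -/

section TensorAlgebraPairing
open TensorAlgebra (ι)
open BraidedTensorAlgebra

section Derivation
variable {k V : Type*} [Field k] [AddCommGroup V] [Module k V]

theorem TensorAlgebra.ιInv_one : TensorAlgebra.ιInv (1 : TensorAlgebra k V) = 0 := by
  -- `ιInv` is the second component of an algebra map into a trivial square-zero extension; this is
  -- the right action used in its definition, so `change` can expose that map.
  let : Module kᵐᵒᵖ V := Module.compHom _ ((RingHom.id k).fromOpposite mul_comm)
  have : IsCentralScalar k V := ⟨fun r m => rfl⟩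
  change TrivSqZeroExt.snd (TensorAlgebra.toTrivSqZeroExt (1 : TensorAlgebra k V)) = 0
  rw [map_one, TrivSqZeroExt.snd_one]

/-- In the square-zero extension `(0, v)(r, m) = (0, r v)`: only the constant term of `x`
contributes to the linear part of `v x`. -/
theorem TensorAlgebra.ιInv_ι_mul (v : V) (x : TensorAlgebra k V) :
    TensorAlgebra.ιInv (ι k v * x) = (TensorAlgebra.algebraMapInv x : k) • v := by
  let : Module kᵐᵒᵖ V := Module.compHom _ ((RingHom.id k).fromOpposite mul_comm)
  have : IsCentralScalar k V := ⟨fun r m => rfl⟩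
  have h : TrivSqZeroExt.fst (TensorAlgebra.toTrivSqZeroExt x) =
      (TensorAlgebra.algebraMapInv x : k) := by
    change ((TrivSqZeroExt.fstHom k k V).comp TensorAlgebra.toTrivSqZeroExt) x = _
    congr 1
    ext; simp [TensorAlgebra.algebraMapInv]
  change TrivSqZeroExt.snd (TensorAlgebra.toTrivSqZeroExt (ι k v * x)) = _
  simp [h]

end Derivation

variable {k G' G W V : Type*} [Field k] [CommGroup G'] [Fintype G'] [CommGroup G] [Fintype G]
  [AddCommGroup W] [Module k W] [YetterDrinfeld k G' W]
  [AddCommGroup V] [Module k V] [YetterDrinfeld k G V]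

/-- The coalgebra underlying a braided bialgebra. -/
@[reducible] def BraidedBialgebra.toCoalgebra (k G A : Type*) [Field k] [CommGroup G] [Fintype G]
    [Ring A] [Algebra k A] [BraidedBialgebra k G A] : Coalgebra k A where
  comul := bcomul k G
  counit := (bcounit k G).toLinearMap
  coassoc := LinearMap.ext bcoassoc
  rTensor_counit_comp_comul := LinearMap.ext rTensor_bcounit_bcomul
  lTensor_counit_comp_comul := LinearMap.ext lTensor_bcounit_bcomul

variable (G) in
/-- The bilinear form on `T(W) × T(V)` which is multiplicative on the left and extends a given
bilinear form on `W × V`. -/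
def tensorForm (b : W →ₗ[k] V →ₗ[k] k) :
    TensorAlgebra k W →ₗ[k] TensorAlgebra k V →ₗ[k] k :=
  -- For the convolution product given by the braided coproduct, the left product law says that `a ↦
  -- ⟨a, ·⟩` is an algebra map into the dual of `T(V)`. The universal property of `T(W)` thus
  -- supplies it, each generator acting through the degree-one part of `T(V)`.
  letI := BraidedBialgebra.toCoalgebra k G (TensorAlgebra k V)
  { toFun a := (TensorAlgebra.lift k (A := WithConv (TensorAlgebra k V →ₗ[k] k))
      { toFun w := WithConv.toConv (b w ∘ₗ TensorAlgebra.ιInv)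
        map_add' _ _ := by rw [map_add, LinearMap.add_comp]; rfl
        map_smul' _ _ := by rw [map_smul, LinearMap.smul_comp]; rfl } a).ofConv
    map_add' _ _ := by rw [map_add]; rfl
    map_smul' _ _ := by rw [map_smul]; rfl }

variable (b : W →ₗ[k] V →ₗ[k] k)

theorem tensorForm_one_left (x : TensorAlgebra k V) :
    tensorForm G b 1 x = TensorAlgebra.algebraMapInv x := by
  let := BraidedBialgebra.toCoalgebra k G (TensorAlgebra k V)
  exact congrArg (fun f : WithConv (TensorAlgebra k V →ₗ[k] k) => f.ofConv x)
    (map_one (TensorAlgebra.lift k (A := WithConv (TensorAlgebra k V →ₗ[k] k)) _))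

theorem tensorForm_ι (w : W) (x : TensorAlgebra k V) :
    tensorForm G b (ι k w) x = b w (TensorAlgebra.ιInv x) := by
  simp only [tensorForm, LinearMap.coe_mk, AddHom.coe_mk, TensorAlgebra.lift_ι_apply]
  rfl

theorem tensorForm_mul (a a' : TensorAlgebra k W) (x : TensorAlgebra k V) :
    tensorForm G b (a * a') x =
      tensorPairing (tensorForm G b) (tensorForm G b) (a ⊗ₜ a') (bcomul k G x) := by
  simp only [tensorForm, LinearMap.coe_mk, AddHom.coe_mk, map_mul]
  rfl

theorem tensorForm_ι_ι_mul (w : W) (v : V) (x : TensorAlgebra k V) :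
    tensorForm G b (ι k w) (ι k v * x) = b w v * TensorAlgebra.algebraMapInv x := by
  rw [tensorForm_ι, TensorAlgebra.ιInv_ι_mul, map_smul, smul_eq_mul, mul_comm]

theorem tensorForm_ι_one (w : W) : tensorForm G b (ι k w) (1 : TensorAlgebra k V) = 0 := by
  rw [tensorForm_ι, TensorAlgebra.ιInv_one, map_zero]

theorem tensorForm_one_right (a : TensorAlgebra k W) :
    tensorForm G b a (1 : TensorAlgebra k V) = TensorAlgebra.algebraMapInv a := by
  induction a using left_induction with
  | one => rw [tensorForm_one_left, map_one, map_one]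
  | smul r x hx => simp [hx]
  | add x y hx hy => simp [hx, hy]
  | mul w a ha =>
    rw [tensorForm_mul, bcomul_one, tensorPairing_tmul, tensorForm_ι_one, zero_mul, counit_ι_mul]

section Compatible
variable {b} {β : G' →* G →* kˣ}

/-- The coproduct of `T(V)` is graded and `β χ` is a character, so the identity passes from two
factors to their product by `sum_mul_sum_inv_mul`. For a generator of `T(W)` only the linear part of
`x` matters, where the identity is the hypothesis on `b`. -/
theorem tensorForm_act_left
    (hb : ∀ (χ : G') w v, b (act k χ w) v = ∑ g, (β χ g : k) * b w (proj k g v))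
    (χ : G') (a : TensorAlgebra k W) (x : TensorAlgebra k V) :
    tensorForm G b (act k χ a) x = ∑ g, (β χ g : k) * tensorForm G b a (proj k g x) := by
  induction a using left_induction generalizing x with
  | one =>
    rw [act_one, Finset.sum_eq_single 1]
    · rw [tensorForm_one_left, tensorForm_one_left]
      have h := Bosonization.bcounit_proj_one (k := k) (Γ := G) x
      simp only [map_one, Units.val_one, one_mul]
      exact h.symm
    · intro g _ hg
      rw [tensorForm_one_left, ← mul_zero]
      congr 1
      exact bcounit_proj _ _ hg
    · simp
  | smul r x hx => simp [hx, Finset.mul_sum, mul_left_comm]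
  | add x y hx hy => simp [hx, hy, mul_add, Finset.sum_add_distrib]
  | mul w a ha =>
    have hw : ∀ x : TensorAlgebra k V, tensorForm G b (act k χ (ι k w)) x =
        ∑ g, (β χ g : k) * tensorForm G b (ι k w) (proj k g x) := by
      intro x
      induction x using left_induction with
      | one =>
        rw [act_ι, tensorForm_ι_one]
        refine (Finset.sum_eq_zero fun g _ => ?_).symm
        by_cases hg : g = 1
        · subst hg; rw [proj_one, tensorForm_ι_one, mul_zero]
        · rw [BraidedTensor.proj_one_of_ne hg, map_zero, mul_zero]
      | smul r x hx => simp [hx, Finset.mul_sum, mul_left_comm]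
      | add x y hx hy => simp [hx, hy, mul_add, Finset.sum_add_distrib]
      | mul v x hx =>
        rw [act_ι, tensorForm_ι_ι_mul, hb]
        simp only [proj_mul, proj_ι, map_sum, tensorForm_ι_ι_mul]
        rw [sum_mul_sum_inv_mul (β χ) (fun g => b w (proj k g v))
          (fun g => TensorAlgebra.algebraMapInv (proj k g x))]
        congr 1
        -- The counit sees only the component of degree `1`, where the character takes the value
        -- `1`.
        rw [Finset.sum_eq_single 1]
        · have h := Bosonization.bcounit_proj_one (k := k) (Γ := G) x
          simp only [map_one, Units.val_one, one_mul]
          exact h.symm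
        · intro g _ hg
          rw [← mul_zero]
          congr 1
          exact bcounit_proj _ _ hg
        · simp
    rw [act_mul, tensorForm_mul]
    simp only [tensorForm_mul, bcomul_proj]
    induction bcomul k G x with
    | zero => simp
    | add s t hs ht => simp only [map_add, hs, ht, Finset.sum_add_distrib, mul_add]
    | tmul x y =>
      simp only [TensorProduct.map_tmul, map_sum, tensorPairing_tmul]
      rw [hw, ha, sum_mul_sum_inv_mul (β χ) (fun g => tensorForm G b (ι k w) (proj k g x))
          (fun g => tensorForm G b a (proj k g y))]

/-- Here the grading sits on `T(W)`, and it is the product of `T(W)` that is split into components.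
The action on `T(V)` passes through the coproduct factor by factor. -/
theorem tensorForm_act_right
    (hb : ∀ (g : G) w v, b w (act k g v) = ∑ χ, (β χ g : k) * b (proj k χ w) v)
    (g : G) (a : TensorAlgebra k W) (x : TensorAlgebra k V) :
    tensorForm G b a (act k g x) = ∑ χ, (β χ g : k) * tensorForm G b (proj k χ a) x := by
  induction a using left_induction generalizing x with
  | one =>
    rw [Finset.sum_eq_single 1]
    · rw [proj_one, tensorForm_one_left, tensorForm_one_left, counit_act]; simp
    · intro χ _ hχ
      rw [BraidedTensor.proj_one_of_ne hχ]; simp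
    · simp
  | smul r x hx => simp [hx, Finset.mul_sum, mul_left_comm]
  | add x y hx hy => simp [hx, hy, mul_add, Finset.sum_add_distrib]
  | mul w a ha =>
    have hw : ∀ x : TensorAlgebra k V, tensorForm G b (ι k w) (act k g x) =
        ∑ χ, (β χ g : k) * tensorForm G b (proj k χ (ι k w)) x := by
      intro x
      induction x using left_induction with
      | one => simp [act_one, proj_ι, tensorForm_ι_one]
      | smul r x hx => simp [hx, Finset.mul_sum, mul_left_comm]
      | add x y hx hy => simp [hx, hy, mul_add, Finset.sum_add_distrib]
      | mul v x hx =>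
        simp only [act_mul, act_ι, proj_ι, tensorForm_ι_ι_mul, hb, counit_act, Finset.sum_mul,
          mul_assoc]
    simp only [proj_mul, map_sum, LinearMap.sum_apply, tensorForm_mul, bcomul_act]
    induction bcomul k G x with
    | zero => simp
    | add s t hs ht => simp only [map_add, hs, ht, Finset.sum_add_distrib, mul_add]
    | tmul x y =>
      simp only [TensorProduct.map_tmul, tensorPairing_tmul]
      rw [hw, ha]
      -- The summation now runs over `G'`, on which `g` acts as the character `χ ↦ β χ g`.
      exact (sum_mul_sum_inv_mul (β.flip g) (fun χ => tensorForm G b (proj k χ (ι k w)) x)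
          (fun χ => tensorForm G b (proj k χ a) y)).symm

/-- The two braidings are adjoint: trading the action of `g` for a grading on one side, and that of
`χ` on the other, turns both expressions into the same double sum weighted by `β χ g`. -/
theorem tensorPairing_braidMiddle {A B : Type*} [Ring A] [Algebra k A] [YDAlgebra k G' A]
    [Ring B] [Algebra k B] [YDAlgebra k G B] (p : A →ₗ[k] B →ₗ[k] k)
    (act_left : ∀ (χ : G') a x, p (act k χ a) x = ∑ g, (β χ g : k) * p a (proj k g x))
    (act_right : ∀ (g : G) a x, p a (act k g x) = ∑ χ, (β χ g : k) * p (proj k χ a) x)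
    (u u' : A ⊗[k] A) (s s' : B ⊗[k] B) :
    tensorPairing (tensorPairing p p) (tensorPairing p p) (u ⊗ₜ u') (braidMiddle k G B (s ⊗ₜ s')) =
      tensorPairing (tensorPairing p p) (tensorPairing p p)
        (braidMiddle k G' A (u ⊗ₜ u')) (s ⊗ₜ s') := by
  induction u with
  | zero => simp
  | add a b ha hb => simp only [map_add, LinearMap.add_apply, TensorProduct.add_tmul, ha, hb]
  | tmul a₁ a₂ =>
  induction u' with
  | zero => simp
  | add a b ha hb => simp only [map_add, LinearMap.add_apply, TensorProduct.tmul_add, ha, hb]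
  | tmul b₁ b₂ =>
  induction s with
  | zero => simp
  | add a b ha hb => simp only [map_add, TensorProduct.add_tmul, ha, hb]
  | tmul x₁ x₂ =>
  induction s' with
  | zero => simp
  | add a b ha hb => simp only [map_add, TensorProduct.tmul_add, ha, hb]
  | tmul y₁ y₂ =>
    simp only [braidMiddle_tmul, map_sum, LinearMap.sum_apply, tensorPairing_tmul, act_left,
      act_right, Finset.mul_sum, Finset.sum_mul]
    rw [Finset.sum_comm]
    refine Finset.sum_congr rfl fun χ _ => Finset.sum_congr rfl fun g _ => ?_
    ring

/-- Once the law is known for `w` and `a`, it follows for `w a`: expand `⟨w a, x y⟩` through `Δ(x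
y)`, apply the law to both factors, move the braiding across the form, and reassemble `Δ(w a)`. Only
generators need direct verification. -/
theorem tensorForm_mul_right
    (hl : ∀ (χ : G') w v, b (act k χ w) v = ∑ g, (β χ g : k) * b w (proj k g v))
    (hr : ∀ (g : G) w v, b w (act k g v) = ∑ χ, (β χ g : k) * b (proj k χ w) v)
    (a : TensorAlgebra k W) (x y : TensorAlgebra k V) :
    tensorForm G b a (x * y) =
      tensorPairing (tensorForm G b) (tensorForm G b) (bcomul k G' a) (x ⊗ₜ y) := by
  induction a using left_induction generalizing x y with
  | one =>
    rw [bcomul_one, tensorPairing_tmul]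
    simp only [tensorForm_one_left, map_mul]
  | smul r a ha => simp [ha]
  | add a a' ha ha' => simp [ha, ha']
  | mul w a ha =>
    have hw : ∀ x y : TensorAlgebra k V, tensorForm G b (ι k w) (x * y) =
        tensorPairing (tensorForm G b) (tensorForm G b) (bcomul k G' (ι k w)) (x ⊗ₜ y) := by
      intro x y
      have h : bcomul k G' (ι k w) = ι k w ⊗ₜ 1 + 1 ⊗ₜ ι k w := comulₗ_ι w
      rw [h, map_add, LinearMap.add_apply, tensorPairing_tmul, tensorPairing_tmul,
        tensorForm_one_left, tensorForm_one_left]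
      induction x using left_induction with
      | one => simp [tensorForm_ι_one]
      | smul r x hx => rw [Algebra.smul_mul_assoc, map_smul, hx]; simp; ring
      | add x x' hx hx' => rw [add_mul, map_add, hx, hx']; simp; ring
      -- Since `ε(v x) = 0`, only the summand `w ⊗ 1` of `Δ w` contributes.
      | mul v x hx =>
        rw [mul_assoc, tensorForm_ι_ι_mul, tensorForm_ι_ι_mul, counit_ι_mul, map_mul]; ring
    -- Transposes the two multiplications of `T(V)` into coproducts of `T(W)`, assuming the law for
    -- `a` and `a'`. The companion `hmul'` does the opposite, where the law holds by construction.
    have hmul : ∀ (a a' : TensorAlgebra k W) (z : (TensorAlgebra k V ⊗[k] TensorAlgebra k V) ⊗[k]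
        (TensorAlgebra k V ⊗[k] TensorAlgebra k V)),
        (∀ x y : TensorAlgebra k V, tensorForm G b a (x * y) =
          tensorPairing (tensorForm G b) (tensorForm G b) (bcomul k G' a) (x ⊗ₜ y)) →
        (∀ x y : TensorAlgebra k V, tensorForm G b a' (x * y) =
          tensorPairing (tensorForm G b) (tensorForm G b) (bcomul k G' a') (x ⊗ₜ y)) →
        tensorPairing (tensorForm G b) (tensorForm G b) (a ⊗ₜ a') (TensorProduct.map
          (LinearMap.mul' k _) (LinearMap.mul' k _) z) =
        tensorPairing (tensorPairing (tensorForm G b) (tensorForm G b))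
          (tensorPairing (tensorForm G b) (tensorForm G b)) (bcomul k G' a ⊗ₜ bcomul k G' a') z := by
      intro a a' z ha ha'
      induction z with
      | zero => simp
      | add s t hs ht => simp only [map_add, hs, ht]
      | tmul s t =>
      induction s with
      | zero => simp
      | add s s' hs hs' => simp only [map_add, TensorProduct.add_tmul, hs, hs']
      | tmul x x' =>
      induction t with
      | zero => simp
      | add s s' hs hs' => simp only [map_add, TensorProduct.tmul_add, hs, hs']
      | tmul y y' => simp [ha, ha']
    have hmul' : ∀ (z : (TensorAlgebra k W ⊗[k] TensorAlgebra k W) ⊗[k]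
        (TensorAlgebra k W ⊗[k] TensorAlgebra k W)),
        tensorPairing (tensorForm G b) (tensorForm G b) (TensorProduct.map
          (LinearMap.mul' k _) (LinearMap.mul' k _) z) (x ⊗ₜ y) =
        tensorPairing (tensorPairing (tensorForm G b) (tensorForm G b))
          (tensorPairing (tensorForm G b) (tensorForm G b)) z (bcomul k G x ⊗ₜ bcomul k G y) := by
      intro z
      induction z with
      | zero => simp
      | add s t hs ht => simp only [map_add, LinearMap.add_apply, hs, ht]
      | tmul s t =>
      induction s with
      | zero => simp
      | add s s' hs hs' =>
        simp only [map_add, LinearMap.add_apply, TensorProduct.add_tmul, hs, hs']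
      | tmul a a' =>
      induction t with
      | zero => simp
      | add s s' hs hs' =>
        simp only [map_add, LinearMap.add_apply, TensorProduct.tmul_add, hs, hs']
      | tmul c c' =>
        simp only [TensorProduct.map_tmul, LinearMap.mul'_apply, tensorPairing_tmul, tensorForm_mul]
    rw [tensorForm_mul, bcomul_mul, bcomul_mul, mulMap_eq_braidMiddle, mulMap_eq_braidMiddle,
      hmul _ _ _ hw ha, hmul', tensorPairing_braidMiddle _ (tensorForm_act_left hl)
        (tensorForm_act_right hr)]

/-- The Hopf pairing of tensor algebras extending a compatible bilinear form on `W × V`. -/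
def BraidedPairing.ofTensorAlgebra (b : W →ₗ[k] V →ₗ[k] k)
    (hl : ∀ (χ : G') w v, b (act k χ w) v = ∑ g, (β χ g : k) * b w (proj k g v))
    (hr : ∀ (g : G) w v, b w (act k g v) = ∑ χ, (β χ g : k) * b (proj k χ w) v) :
    BraidedPairing β (TensorAlgebra k W) (TensorAlgebra k V) where
  form := tensorForm G b
  one_left := tensorForm_one_left b
  one_right := tensorForm_one_right b
  mul_left := tensorForm_mul b
  mul_right := tensorForm_mul_right hl hr
  act_left := tensorForm_act_left hl
  act_right := tensorForm_act_right hr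

theorem BraidedPairing.ofTensorAlgebra_ι_ι (b : W →ₗ[k] V →ₗ[k] k)
    (hl : ∀ (χ : G') w v, b (act k χ w) v = ∑ g, (β χ g : k) * b w (proj k g v))
    (hr : ∀ (g : G) w v, b w (act k g v) = ∑ χ, (β χ g : k) * b (proj k χ w) v) (w : W) (v : V) :
    (ofTensorAlgebra b hl hr).form (ι k w) (ι k v) = b w v := by
  rw [ofTensorAlgebra, tensorForm_ι, TensorAlgebra.ι_leftInverse]

end Compatible
end TensorAlgebraPairing

/-! ### Independence of characters, and nondegeneracy on tensor squares -/

section Characters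
variable {k G' G : Type*} [Field k] [CommGroup G'] [Fintype G'] [CommGroup G]

/-- Dedekind's independence of characters: injectivity of `β` makes the `β χ` pairwise distinct. It
serves to separate graded components from one another. -/
theorem eq_zero_of_sum_bicharacter_mul_eq_zero {β : G' →* G →* kˣ} (hβ : Function.Injective β)
    (c : G' → k) (h : ∀ g, ∑ χ, (β χ g : k) * c χ = 0) (χ : G') : c χ = 0 := by
  have hinj : Function.Injective fun χ : G' => (Units.coeHom k).comp (β χ) := fun χ χ' e =>
    hβ (MonoidHom.ext fun g => Units.ext (DFunLike.congr_fun e g))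
  have hli := (linearIndependent_monoidHom G k).comp _ hinj
  refine Fintype.linearIndependent_iff.mp hli c (funext fun g => ?_) χ
  simpa [mul_comm] using h g

end Characters

section TensorSeparation
variable {k A B : Type*} [Field k] [AddCommGroup A] [Module k A] [AddCommGroup B] [Module k B]

/-- Write the tensor as `∑ e_i ⊗ s_i` with a basis `e`. For fixed `y` the vector `∑ p(s_i, y) e_i`
is killed by the form, hence zero, so every `p(s_i, y)` vanishes. No finite dimension enters, which
matters because it is applied to quotients of tensor algebras. -/
theorem eq_zero_of_tensorPairing_eq_zero {p : A →ₗ[k] B →ₗ[k] k} (hp : Function.Injective p)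
    (t : A ⊗[k] A) (ht : ∀ x y, tensorPairing p p t (x ⊗ₜ y) = 0) : t = 0 := by
  classical
  let e := Module.Basis.ofVectorSpace k A
  have h0 : ∀ a, (∀ x, p a x = 0) → a = 0 := fun a ha =>
    hp (by rw [map_zero]; exact LinearMap.ext ha)
  have key : ∀ s : Module.Basis.ofVectorSpaceIndex k A →₀ A,
      (∀ x y, tensorPairing p p ((TensorProduct.equivFinsuppOfBasisLeft e).symm s) (x ⊗ₜ y) = 0) →
      s = 0 := by
    intro s hs
    ext i
    refine h0 _ fun y => ?_
    have h1 : ∑ i ∈ s.support, p (s i) y • e i = 0 := by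
      refine h0 _ fun x => ?_
      rw [← hs x y, TensorProduct.equivFinsuppOfBasisLeft_symm_apply, Finsupp.sum]
      simp [LinearMap.sum_apply, mul_comm]
    by_cases hi : i ∈ s.support
    · exact linearIndependent_iff'.mp e.linearIndependent _ _ h1 i hi
    · rw [Finsupp.notMem_support_iff.mp hi]; simp
  have := key (TensorProduct.equivFinsuppOfBasisLeft e t) (by simpa using ht)
  simpa using this

end TensorSeparation

/-! ### The radical of a braided Hopf pairing -/

section Radical
variable {k G' G A B : Type*} [Field k] [CommGroup G'] [Fintype G'] [CommGroup G] [Fintype G]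
  {β : G' →* G →* kˣ} [Ring A] [Algebra k A] [BraidedBialgebra k G' A] [Ring B] [Algebra k B]
  [BraidedBialgebra k G B]

namespace BraidedPairing

theorem form_mul_eq_zero_left (P : BraidedPairing β A B) {a : A} (ha : P.form a = 0) (b : A) :
    P.form (a * b) = 0 := by
  ext x
  rw [P.mul_left]
  induction bcomul k G x with
  | zero => simp
  | add s t hs ht => rw [map_add, hs, ht]; simp
  | tmul x y => simp [ha]

theorem form_mul_eq_zero_right (P : BraidedPairing β A B) (b : A) {a : A} (ha : P.form a = 0) :
    P.form (b * a) = 0 := by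
  ext x
  rw [P.mul_left]
  induction bcomul k G x with
  | zero => simp
  | add s t hs ht => rw [map_add, hs, ht]; simp
  | tmul x y => simp [ha]

/-- The left radical of a pairing. -/
def leftRadical (P : BraidedPairing β A B) : Ideal A where
  carrier := {a | P.form a = 0}
  add_mem' ha hb := by rw [Set.mem_ofPred_eq, map_add, ha, hb, add_zero]
  zero_mem' := map_zero _
  smul_mem' b _ ha := P.form_mul_eq_zero_right b ha

theorem mem_leftRadical {P : BraidedPairing β A B} {a : A} :
    a ∈ P.leftRadical ↔ P.form a = 0 := Iff.rfl

/-- Each closure property is adjoint to a structure on the other side. Stability under the grading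
is the one that needs `β` injective: if `a` is in the radical, the sums `∑ β(χ, g) ⟨a_χ, x⟩ = ⟨a, g
x⟩` vanish for all `g`, hence so does every term. -/
theorem leftRadical_isBraidedBiideal (P : BraidedPairing β A B) (hβ : Function.Injective β) :
    IsBraidedBiideal k G' P.leftRadical where
  isTwoSided := ⟨fun b ha => P.form_mul_eq_zero_left ha b⟩
  act_mem χ a ha := by
    rw [mem_leftRadical] at ha ⊢
    ext x
    rw [P.act_left, ha]
    simp
  proj_mem χ a ha := by
    rw [mem_leftRadical] at ha ⊢
    ext x
    refine eq_zero_of_sum_bicharacter_mul_eq_zero hβ (fun χ => P.form (proj k χ a) x) (fun g => ?_) χ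
    rw [← P.act_right, ha, LinearMap.zero_apply]
  bcomul_mem a ha := by
    rw [mem_leftRadical] at ha
    let J := P.leftRadical.restrictScalars k
    -- Modulo its radical the form is injective on the left, hence so is its tensor square. The
    -- image of `Δ a` in `A/J ⊗ A/J` pairs to zero with everything, so `Δ a` lies in the kernel `J ⊗
    -- A + A ⊗ J` of the projection.
    let f : (A ⧸ J) →ₗ[k] B →ₗ[k] k := J.liftQ P.form fun a ha => ha
    have hf : Function.Injective f := by
      refine (injective_iff_map_eq_zero f).mpr fun q hq => ?_
      obtain ⟨a, rfl⟩ := J.mkQ_surjective q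
      exact (Submodule.Quotient.mk_eq_zero J).mpr hq
    have hmap : ∀ t x y, tensorPairing f f (TensorProduct.map J.mkQ J.mkQ t) (x ⊗ₜ y) =
        tensorPairing P.form P.form t (x ⊗ₜ y) := by
      intro t x y
      induction t with
      | zero => simp
      | add s t hs ht => simp only [map_add, LinearMap.add_apply, hs, ht]
      | tmul a b => rfl
    have hker : bcomul k G' a ∈ LinearMap.ker (TensorProduct.map J.mkQ J.mkQ) := by
      refine eq_zero_of_tensorPairing_eq_zero hf _ fun x y => ?_
      rw [hmap, ← P.mul_right, ha, LinearMap.zero_apply]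
    have hex : Function.Exact J.subtype J.mkQ := LinearMap.exact_subtype_mkQ J
    rw [TensorProduct.map_ker hex J.mkQ_surjective hex J.mkQ_surjective, sup_comm] at hker
    exact hker
  bcounit_eq_zero a ha := by
    rw [← P.one_right, mem_leftRadical.mp ha, LinearMap.zero_apply]

end BraidedPairing
end Radical

/-! ### The Nichols ideal as the radical of a pairing of tensor algebras -/

section TensorAlgebraRadical
open TensorAlgebra (ι)
open BraidedTensorAlgebra

section Scaling
variable {k V : Type*} [Field k] [AddCommGroup V] [Module k V]

/-- The algebra endomorphism of the tensor algebra scaling the generators by `c`. -/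
def tensorScale (c : k) : TensorAlgebra k V →ₐ[k] TensorAlgebra k V := TensorAlgebra.lift k (c • ι k)

theorem tensorScale_ι (c : k) (v : V) : tensorScale c (ι k v) = c • ι k v := by
  simp [tensorScale]

theorem tensorScale_of_mem_pow (c : k) {n : ℕ} {x : TensorAlgebra k V}
    (hx : x ∈ LinearMap.range (ι k : V →ₗ[k] TensorAlgebra k V) ^ n) :
    tensorScale c x = c ^ n • x := by
  induction hx using Submodule.pow_induction_on_left' with
  | algebraMap r => simp
  | add x y i _ _ hx hy => rw [map_add, hx, hy, smul_add]
  | mem_mul m hm i x _ hx =>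
    obtain ⟨v, rfl⟩ := hm
    rw [map_mul, hx, tensorScale_ι, smul_mul_smul_comm, pow_succ']

variable {G : Type*} [CommGroup G] [Fintype G] [YetterDrinfeld k G V]

theorem tensorScale_act (c : k) (g : G) (x : TensorAlgebra k V) :
    tensorScale c (act k g x) = act k g (tensorScale c x) := by
  induction x using left_induction with
  | one => simp [act_one]
  | smul r x hx => simp [hx]
  | add x y hx hy => simp [hx, hy]
  | mul v x hx => simp [act_mul, hx, act_ι, tensorScale_ι]

/-- Scaling the generators respects primitivity and commutes with the action, so it is compatible
with the braided coproduct. -/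
theorem bcomul_tensorScale (c : k) (x : TensorAlgebra k V) :
    bcomul k G (tensorScale c x) = TensorProduct.map (tensorScale c).toLinearMap
      (tensorScale c).toLinearMap (bcomul k G x) := by
  induction x using left_induction with
  | one => simp [bcomul_one]
  | smul r x hx => simp [hx]
  | add x y hx hy => simp [hx, hy]
  | mul v x hx =>
    have h : ∀ y, bcomul k G (ι k v * y) = L G v (bcomul k G y) := comulₗ_ι_mul v
    rw [map_mul, tensorScale_ι, Algebra.smul_mul_assoc, map_smul, h, h, hx]
    induction bcomul k G x with
    | zero => simp
    | add s t hs ht => simp only [map_add, smul_add, hs, ht]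
    | tmul y z =>
      simp only [TensorProduct.map_tmul, L_tmul, AlgHom.toLinearMap_apply, map_add, map_sum,
        map_mul, tensorScale_ι, tensorScale_act, smul_add, Finset.smul_sum, Algebra.smul_mul_assoc,
        TensorProduct.tmul_smul, TensorProduct.smul_tmul']

theorem bcounit_tensorScale (c : k) (x : TensorAlgebra k V) :
    bcounit k G (tensorScale c x) = bcounit k G x := by
  induction x using left_induction with
  | one => simp
  | smul r x hx => simp [hx]
  | add x y hx hy => simp [hx, hy]
  | mul v x hx =>
    have h : ∀ y, bcounit k G (ι k v * y) = 0 := counit_ι_mul v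
    rw [map_mul, tensorScale_ι, Algebra.smul_mul_assoc, map_smul, h, h, smul_zero]

end Scaling

variable {k G' G W V : Type*} [Field k] [CommGroup G'] [Fintype G'] [CommGroup G] [Fintype G]
  [AddCommGroup W] [Module k W] [YetterDrinfeld k G' W]
  [AddCommGroup V] [Module k V] [YetterDrinfeld k G V] {β : G' →* G →* kˣ}

namespace BraidedPairing
variable (P : BraidedPairing β (TensorAlgebra k W) (TensorAlgebra k V))

theorem form_ι_one (w : W) : P.form (ι k w) 1 = 0 := by
  rw [P.one_right, ← mul_one (ι k w)]
  exact counit_ι_mul w 1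

theorem form_ι_ι_mul (w : W) (v : V) (x : TensorAlgebra k V) :
    P.form (ι k w) (ι k v * x) = P.form (ι k w) (ι k v) * bcounit k G x := by
  have h : bcomul k G' (ι k w) = ι k w ⊗ₜ 1 + 1 ⊗ₜ ι k w := comulₗ_ι w
  have h' := P.flip.form_ι_one v
  rw [P.mul_right, h, map_add, LinearMap.add_apply, tensorPairing_tmul, tensorPairing_tmul,
    P.one_left x, show P.form 1 (ι k v) = 0 from h', zero_mul, add_zero]

/-- Scaling is self-adjoint. This encodes compatibility with the tensor degree without expanding
iterated coproducts. -/
theorem form_tensorScale (c : k) (a : TensorAlgebra k W) (x : TensorAlgebra k V) :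
    P.form (tensorScale c a) x = P.form a (tensorScale c x) := by
  induction a using left_induction generalizing x with
  | one => rw [map_one, P.one_left, P.one_left, bcounit_tensorScale]
  | smul r a ha => simp [ha]
  | add a a' ha ha' => simp [ha, ha']
  | mul w a ha =>
    have hw : ∀ x, P.form (tensorScale c (ι k w)) x = P.form (ι k w) (tensorScale c x) := by
      intro x
      induction x using left_induction with
      | one => simp [tensorScale_ι, form_ι_one]
      | smul r x hx => simp [hx]
      | add x y hx hy => simp [hx, hy]
      | mul v x hx =>
        rw [map_mul (tensorScale c), tensorScale_ι, tensorScale_ι, Algebra.smul_mul_assoc, map_smul,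
          map_smul, LinearMap.smul_apply, form_ι_ι_mul, form_ι_ι_mul, bcounit_tensorScale]
    rw [map_mul, P.mul_left, P.mul_left, bcomul_tensorScale]
    induction bcomul k G x with
    | zero => simp
    | add s t hs ht => simp only [map_add, hs, ht]
    | tmul y z =>
      simp only [TensorProduct.map_tmul, tensorPairing_tmul, hw, ha, AlgHom.toLinearMap_apply]

theorem form_eq_zero_of_ne [CharZero k] {n m : ℕ} (hnm : n ≠ m) {a : TensorAlgebra k W}
    {x : TensorAlgebra k V} (ha : a ∈ LinearMap.range (ι k : W →ₗ[k] TensorAlgebra k W) ^ n)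
    (hx : x ∈ LinearMap.range (ι k : V →ₗ[k] TensorAlgebra k V) ^ m) : P.form a x = 0 := by
  -- Self-adjointness gives `2 ^ n ⟨a, x⟩ = 2 ^ m ⟨a, x⟩`, and the powers of `2` are distinct in
  -- characteristic zero.
  have h := P.form_tensorScale 2 a x
  rw [tensorScale_of_mem_pow _ ha, tensorScale_of_mem_pow _ hx, map_smul, map_smul,
    LinearMap.smul_apply, smul_eq_mul, smul_eq_mul] at h
  refine (mul_eq_mul_right_iff.mp h).resolve_left fun e => hnm ?_
  exact Nat.pow_right_injective (le_refl 2) (by exact_mod_cast e)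

/-- By orthogonality of different degrees, both sides equal the pairing of the two components of
degree `n`. -/
theorem form_decompose_left [CharZero k] (n : ℕ) (a : TensorAlgebra k W) (x : TensorAlgebra k V) :
    P.form (DirectSum.decompose
      (fun n : ℕ => LinearMap.range (ι k : W →ₗ[k] TensorAlgebra k W) ^ n) a n) x =
    P.form a (DirectSum.decompose
      (fun n : ℕ => LinearMap.range (ι k : V →ₗ[k] TensorAlgebra k V) ^ n) x n) := by
  classical
  set 𝒜 := fun n : ℕ => LinearMap.range (ι k : W →ₗ[k] TensorAlgebra k W) ^ n
  set ℬ := fun n : ℕ => LinearMap.range (ι k : V →ₗ[k] TensorAlgebra k V) ^ n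
  have h1 : P.form (DirectSum.decompose 𝒜 a n) x =
      P.form (DirectSum.decompose 𝒜 a n) (DirectSum.decompose ℬ x n) := by
    conv_lhs => rw [← DirectSum.sum_support_decompose ℬ x, map_sum]
    rw [Finset.sum_eq_single n]
    · intro m _ hm
      exact P.form_eq_zero_of_ne hm.symm (SetLike.coe_mem _) (SetLike.coe_mem _)
    · intro hn
      rw [DFinsupp.notMem_support_iff.mp hn]; simp
  have h2 : P.form a (DirectSum.decompose ℬ x n) =
      P.form (DirectSum.decompose 𝒜 a n) (DirectSum.decompose ℬ x n) := by
    conv_lhs => rw [← DirectSum.sum_support_decompose 𝒜 a, map_sum, LinearMap.sum_apply]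
    rw [Finset.sum_eq_single n]
    · intro m _ hm
      exact P.form_eq_zero_of_ne hm (SetLike.coe_mem _) (SetLike.coe_mem _)
    · intro hn
      rw [DFinsupp.notMem_support_iff.mp hn]; simp
  rw [h1, h2]

/-- Homogeneity comes from adjointness of the degree projections. A radical element of degree zero
is detected by pairing with `1`, one of degree one by the assumed nondegeneracy on `W`. -/
theorem leftRadical_isNicholsIdeal [CharZero k] (hβ : Function.Injective β)
    (hP : ∀ w, (∀ v, P.form (ι k w) (ι k v) = 0) → w = 0) :
    IsNicholsIdeal k G' W P.leftRadical where
  toIsBraidedBiideal := P.leftRadical_isBraidedBiideal hβ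
  isHomogeneous := by
    intro n a ha
    rw [mem_leftRadical] at ha ⊢
    ext x
    rw [form_decompose_left, ha]; simp
  decompose_eq_zero a ha n hn := by
    have h : P.form (DirectSum.decompose
      (fun n : ℕ => LinearMap.range (ι k : W →ₗ[k] TensorAlgebra k W) ^ n) a n) = 0 := by
      ext x
      rw [form_decompose_left, mem_leftRadical.mp ha]; simp
    have hmem := SetLike.coe_mem (DirectSum.decompose
      (fun n : ℕ => LinearMap.range (ι k : W →ₗ[k] TensorAlgebra k W) ^ n) a n)
    revert h hmem
    generalize ((DirectSum.decompose
      (fun n : ℕ => LinearMap.range (ι k : W →ₗ[k] TensorAlgebra k W) ^ n) a n) :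
      TensorAlgebra k W) = b
    intro h hmem
    interval_cases n
    · rw [pow_zero, Submodule.mem_one] at hmem
      obtain ⟨r, rfl⟩ := hmem
      have h1 := P.one_right (algebraMap k _ r)
      rw [h, AlgHom.commutes, LinearMap.zero_apply, Algebra.algebraMap_self, RingHom.id_apply] at h1
      rw [← h1, map_zero]
    · rw [pow_one] at hmem
      obtain ⟨w, rfl⟩ := hmem
      rw [hP w fun v => by rw [h, LinearMap.zero_apply], map_zero]

/-- Needs no nondegeneracy. In `⟨a, v x⟩ = ⟨Δ a, v ⊗ x⟩` the part of `Δ a` in `I ⊗ T` dies against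
`v`, as `I` has no component of degree one, and the part in `T ⊗ I` dies against `x` by induction.
-/
theorem le_leftRadical [CharZero k] {I : Ideal (TensorAlgebra k W)} (hI : IsNicholsIdeal k G' W I) :
    I ≤ P.leftRadical := by
  suffices h : ∀ x : TensorAlgebra k V, ∀ a ∈ I, P.form a x = 0 from
    fun a ha => LinearMap.ext fun x => h x a ha
  intro x
  induction x using left_induction with
  | one => intro a ha; rw [P.one_right, hI.bcounit_eq_zero a ha]
  | smul r x hx => intro a ha; rw [map_smul, hx a ha, smul_zero]
  | add x y hx hy => intro a ha; rw [map_add, hx a ha, hy a ha, add_zero]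
  | mul v x hx =>
    intro a ha
    have hv : ∀ b ∈ I, P.form b (ι k v) = 0 := by
      intro b hb
      have h1 : ι k v ∈ LinearMap.range (ι k : V →ₗ[k] TensorAlgebra k V) ^ 1 := by
        rw [pow_one]; exact ⟨v, rfl⟩
      have h2 := P.form_decompose_left 1 b (ι k v)
      rw [DirectSum.decompose_of_mem_same
        (fun n : ℕ => LinearMap.range (ι k : V →ₗ[k] TensorAlgebra k V) ^ n) h1] at h2
      rw [← h2, hI.decompose_eq_zero b hb 1 one_lt_two, map_zero, LinearMap.zero_apply]
    rw [P.mul_right]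
    obtain ⟨_, ⟨s, rfl⟩, _, ⟨t, rfl⟩, h⟩ := Submodule.mem_sup.mp (hI.bcomul_mem a ha)
    rw [← h, map_add, LinearMap.add_apply]
    have hl : ∀ s, tensorPairing P.form P.form ((I.restrictScalars k).subtype.rTensor _ s)
        (ι k v ⊗ₜ x) = 0 := by
      intro s
      induction s with
      | zero => simp
      | add s t hs ht => rw [map_add, map_add, LinearMap.add_apply, hs, ht, add_zero]
      | tmul b c => simp [hv b b.2]
    have hr : ∀ t, tensorPairing P.form P.form ((I.restrictScalars k).subtype.lTensor _ t)
        (ι k v ⊗ₜ x) = 0 := by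
      intro t
      induction t with
      | zero => simp
      | add s t hs ht => rw [map_add, map_add, LinearMap.add_apply, hs, ht, add_zero]
      | tmul b c => simp [hx c c.2]
    rw [hl, hr, add_zero]

/-- The Nichols ideal is the radical of the Hopf pairing. -/
theorem nicholsIdeal_eq_leftRadical [CharZero k] (hβ : Function.Injective β)
    (hP : ∀ w, (∀ v, P.form (ι k w) (ι k v) = 0) → w = 0) :
    nicholsIdeal k G' W = P.leftRadical :=
  le_antisymm (sSup_le fun _ hI => P.le_leftRadical hI)
    (le_sSup (P.leftRadical_isNicholsIdeal hβ hP))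

end BraidedPairing
end TensorAlgebraRadical

/-! ### The induced pairing of Nichols algebras -/

section NicholsPairing
open TensorAlgebra (ι)

variable {k G' G W V : Type*} [Field k] [CommGroup G'] [Fintype G'] [CommGroup G] [Fintype G]
  [AddCommGroup W] [Module k W] [YetterDrinfeld k G' W]
  [AddCommGroup V] [Module k V] [YetterDrinfeld k G V] {β : G' →* G →* kˣ}

namespace BraidedPairing
variable (P : BraidedPairing β (TensorAlgebra k W) (TensorAlgebra k V))

variable (k G V) in
/-- The projection of the tensor algebra onto the Nichols algebra. -/
abbrev nicholsMk : TensorAlgebra k V →ₐ[k] NicholsAlgebra k G V :=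
  Ideal.Quotient.mkₐ k (nicholsIdeal k G V)

/-- The form induced on Nichols algebras. -/
def nicholsForm (hl : nicholsIdeal k G' W = P.leftRadical)
    (hr : nicholsIdeal k G V = P.flip.leftRadical) :
    NicholsAlgebra k G' W →ₗ[k] NicholsAlgebra k G V →ₗ[k] k :=
  IsBraidedBiideal.liftLinear k _
    (IsBraidedBiideal.liftLinear k _ P.form.flip fun x hx => by
      rw [hr] at hx; exact hx).flip fun a ha => by
    rw [hl, mem_leftRadical] at ha
    refine LinearMap.ext fun x => ?_
    obtain ⟨x, rfl⟩ := IsBraidedBiideal.mk_surj (k := k) x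
    exact DFunLike.congr_fun ha x

variable (hl : nicholsIdeal k G' W = P.leftRadical)
  (hr : nicholsIdeal k G V = P.flip.leftRadical)

/-- The coproduct of a quotient is the image of the coproduct upstairs, so this brings both product
laws of `nichols` back to those of `P`. -/
theorem tensorPairing_nicholsForm_map (s : TensorAlgebra k W ⊗[k] TensorAlgebra k W)
    (t : TensorAlgebra k V ⊗[k] TensorAlgebra k V) :
    tensorPairing (P.nicholsForm hl hr) (P.nicholsForm hl hr)
      (TensorProduct.map (nicholsMk k G' W).toLinearMap (nicholsMk k G' W).toLinearMap s)
      (TensorProduct.map (nicholsMk k G V).toLinearMap (nicholsMk k G V).toLinearMap t) =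
    tensorPairing P.form P.form s t := by
  induction s with
  | zero => simp
  | add a b ha hb => simp only [map_add, LinearMap.add_apply, ha, hb]
  | tmul a b =>
  induction t with
  | zero => simp
  | add a b ha hb => simp only [map_add, ha, hb]
  | tmul x y => rfl

/-- The pairing of Nichols algebras induced by a pairing of tensor algebras. -/
def nichols : BraidedPairing β (NicholsAlgebra k G' W) (NicholsAlgebra k G V) where
  form := P.nicholsForm hl hr
  one_left x := by
    obtain ⟨x, rfl⟩ := IsBraidedBiideal.mk_surj (k := k) x
    exact P.one_left x
  one_right a := by
    obtain ⟨a, rfl⟩ := IsBraidedBiideal.mk_surj (k := k) a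
    exact P.one_right a
  mul_left a b x := by
    obtain ⟨a, rfl⟩ := IsBraidedBiideal.mk_surj (k := k) a
    obtain ⟨b, rfl⟩ := IsBraidedBiideal.mk_surj (k := k) b
    obtain ⟨x, rfl⟩ := IsBraidedBiideal.mk_surj (k := k) x
    exact (P.mul_left a b x).trans (P.tensorPairing_nicholsForm_map hl hr (a ⊗ₜ b) _).symm
  mul_right a x y := by
    obtain ⟨a, rfl⟩ := IsBraidedBiideal.mk_surj (k := k) a
    obtain ⟨x, rfl⟩ := IsBraidedBiideal.mk_surj (k := k) x
    obtain ⟨y, rfl⟩ := IsBraidedBiideal.mk_surj (k := k) y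
    exact (P.mul_right a x y).trans (P.tensorPairing_nicholsForm_map hl hr _ (x ⊗ₜ y)).symm
  act_left χ a x := by
    obtain ⟨a, rfl⟩ := IsBraidedBiideal.mk_surj (k := k) a
    obtain ⟨x, rfl⟩ := IsBraidedBiideal.mk_surj (k := k) x
    exact P.act_left χ a x
  act_right g a x := by
    obtain ⟨a, rfl⟩ := IsBraidedBiideal.mk_surj (k := k) a
    obtain ⟨x, rfl⟩ := IsBraidedBiideal.mk_surj (k := k) x
    exact P.act_right g a x

/-- The ideal divided out is the whole radical, so nothing degenerate remains. -/
theorem nichols_form_injective : Function.Injective (P.nichols hl hr).form := by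
  refine (injective_iff_map_eq_zero _).mpr fun a ha => ?_
  obtain ⟨a, rfl⟩ := IsBraidedBiideal.mk_surj (k := k) a
  refine IsBraidedBiideal.mk_eq_zero ?_
  rw [hl, mem_leftRadical]
  exact LinearMap.ext fun x => DFunLike.congr_fun ha (nicholsMk k G V x)

theorem nichols_flip_form_injective : Function.Injective (P.nichols hl hr).form.flip := by
  refine (injective_iff_map_eq_zero _).mpr fun x hx => ?_
  obtain ⟨x, rfl⟩ := IsBraidedBiideal.mk_surj (k := k) x
  refine IsBraidedBiideal.mk_eq_zero ?_
  rw [hr, mem_leftRadical]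
  exact LinearMap.ext fun a => DFunLike.congr_fun hx (nicholsMk k G' W a)

end BraidedPairing
end NicholsPairing

/-! ### From braided pairings to perfect Hopf pairings of bosonizations -/

section BosonizationPairing
open MonoidAlgebra (single)
open Bosonization (mkₗ)

variable {k G' G A B : Type*} [Field k] [CommGroup G'] [Fintype G'] [CommGroup G] [Fintype G]
  {β : G' →* G →* kˣ} [Ring A] [Algebra k A] [BraidedBialgebra k G' A] [Ring B] [Algebra k B]
  [BraidedBialgebra k G B]

/-- The bilinear extension of a bicharacter to group algebras. -/
def groupAlgebraForm (β : G' →* G →* kˣ) : MonoidAlgebra k G' →ₗ[k] MonoidAlgebra k G →ₗ[k] k :=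
  ∑ χ : G', ∑ g : G, (β χ g : k) •
    (Finsupp.lapply χ ∘ₗ (MonoidAlgebra.coeffLinearEquiv k).toLinearMap).smulRight
      (Finsupp.lapply g ∘ₗ (MonoidAlgebra.coeffLinearEquiv k).toLinearMap)

theorem groupAlgebraForm_single (χ : G') (g : G) :
    groupAlgebraForm β (single χ (1 : k)) (single g (1 : k)) = β χ g := by
  classical
  simp [groupAlgebraForm, LinearMap.sum_apply, Finsupp.single_apply]

theorem Bosonization.exists_eq_sum_mkₗ (t : Bosonization k G B) :
    ∃ f : G → B, t = ∑ g, mkₗ g (f g) := by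
  classical
  induction t using Bosonization.induction_on with
  | zero => exact ⟨0, by simp⟩
  | add s t hs ht =>
    obtain ⟨f, rfl⟩ := hs
    obtain ⟨f', rfl⟩ := ht
    exact ⟨f + f', by simp [Finset.sum_add_distrib]⟩
  | h x g =>
    refine ⟨Pi.single g x, ?_⟩
    rw [Finset.sum_eq_single g]
    · rw [Pi.single_eq_same]; rfl
    · intro h _ hh; rw [Pi.single_eq_of_ne hh, map_zero]
    · simp

namespace BraidedPairing
variable (P : BraidedPairing β A B)

/-- The pairing `⟨a # χ, x # g⟩ = ⟨a, x⟩ β(χ, g)` of bosonizations. -/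
def bosonizationForm : Bosonization k G' A →ₗ[k] Bosonization k G B →ₗ[k] k :=
  (tensorPairing P.form (groupAlgebraForm β)).compl₁₂
    (BraidedTensor.of k G' A (MonoidAlgebra k G')).symm.toLinearMap
    (BraidedTensor.of k G B (MonoidAlgebra k G)).symm.toLinearMap

theorem bosonizationForm_mkₗ (χ : G') (a : A) (g : G) (x : B) :
    P.bosonizationForm (mkₗ χ a) (mkₗ g x) = P.form a x * β χ g := by
  rw [← groupAlgebraForm_single]
  rfl

theorem bosonizationForm_flip : P.flip.bosonizationForm = P.bosonizationForm.flip :=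
  Bosonization.linearMap_ext fun g x => Bosonization.linearMap_ext fun χ a => by
    rw [LinearMap.flip_apply, bosonizationForm_mkₗ, bosonizationForm_mkₗ]
    rfl

/-- Pairing `∑ f(χ) # χ` with `x # g` gives `∑ β(χ, g) ⟨f(χ), x⟩`; independence of the characters `β
χ` isolates each `f(χ)`. -/
theorem bosonizationForm_injective (hβ : Function.Injective β) (hP : Function.Injective P.form) :
    Function.Injective P.bosonizationForm := by
  refine (injective_iff_map_eq_zero _).mpr fun t ht => ?_
  obtain ⟨f, rfl⟩ := Bosonization.exists_eq_sum_mkₗ t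
  refine Finset.sum_eq_zero fun χ _ => ?_
  suffices h : f χ = 0 by rw [h, map_zero]
  refine hP ?_
  rw [map_zero]
  ext x
  refine eq_zero_of_sum_bicharacter_mul_eq_zero hβ (fun χ => P.form (f χ) x) (fun g => ?_) χ
  have h := DFunLike.congr_fun ht (mkₗ g x)
  simp only [map_sum, LinearMap.sum_apply, bosonizationForm_mkₗ, LinearMap.zero_apply] at h
  simpa only [mul_comm] using h

/-- The product `(a # χ)(b # ψ)` lets `χ` act on `b`, while `Δ(x # h)` multiplies `h` by the degree
`g` of the second tensor factor. The factor `β(χ, g)` coming from `β(χ, g h)` is the one that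
`act_left` produces from `χ • b`. -/
theorem bosonizationForm_mul_left (s t : Bosonization k G' A) (z : Bosonization k G B) :
    P.bosonizationForm (s * t) z = tensorPairing P.bosonizationForm P.bosonizationForm (s ⊗ₜ t)
      (Coalgebra.comul (R := k) z) := by
  induction s using Bosonization.induction_on with
  | zero => simp
  | add s s' hs hs' =>
    rw [add_mul, map_add, LinearMap.add_apply, hs, hs']
    simp [TensorProduct.add_tmul]
  | h a χ =>
  induction t using Bosonization.induction_on with
  | zero => simp
  | add s s' hs hs' =>
    rw [mul_add, map_add, LinearMap.add_apply, hs, hs']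
    simp [TensorProduct.tmul_add]
  | h b ψ =>
  induction z using Bosonization.induction_on with
  | zero => simp
  | add s s' hs hs' => rw [map_add, map_add, map_add, hs, hs']
  | h x h =>
    simp only [Bosonization.mk_eq, Bosonization.mk_mul_mk, bosonizationForm_mkₗ,
      Bosonization.comul_mk, P.mul_left]
    induction bcomul k G x with
    | zero => simp
    | add s t hs ht => simp only [map_add, add_mul, hs, ht]
    | tmul x y =>
      simp only [Bosonization.Θ_tmul, map_sum, tensorPairing_tmul, bosonizationForm_mkₗ,
        P.act_left, Finset.mul_sum, Finset.sum_mul, map_mul, MonoidHom.mul_apply, Units.val_mul]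
      exact Finset.sum_congr rfl fun g _ => by ring

theorem bosonizationForm_mul_right (z : Bosonization k G' A) (s t : Bosonization k G B) :
    P.bosonizationForm z (s * t) = tensorPairing P.bosonizationForm P.bosonizationForm
      (Coalgebra.comul (R := k) z) (s ⊗ₜ t) := by
  have h := P.flip.bosonizationForm_mul_left s t z
  rwa [bosonizationForm_flip, tensorPairing_flip] at h

theorem bosonizationForm_one_left (z : Bosonization k G B) :
    P.bosonizationForm 1 z = Coalgebra.counit (R := k) z := by
  induction z using Bosonization.induction_on with
  | zero => simp
  | add s t hs ht => rw [map_add, map_add, hs, ht]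
  | h x g =>
    rw [Bosonization.mk_eq, Bosonization.counit_mk, Bosonization.one_eq, bosonizationForm_mkₗ,
      P.one_left]
    simp

theorem bosonizationForm_one_right (z : Bosonization k G' A) :
    P.bosonizationForm z 1 = Coalgebra.counit (R := k) z := by
  have h := P.flip.bosonizationForm_one_left z
  rwa [bosonizationForm_flip] at h

variable [FiniteDimensional k B]

/-- The map from one bosonization to the dual of the other given by a pairing. -/
def toDualBialgebra : Bosonization k G' A →ₐc[k] DualBialgebra k (Bosonization k G B) :=
  BialgHom.ofAlgHom
    (AlgHom.ofLinearMap ((DualBialgebra.toDual k _).symm.toLinearMap ∘ₗ P.bosonizationForm)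
      ((DualBialgebra.toDual k _).injective (LinearMap.ext P.bosonizationForm_one_left))
      fun s t => (DualBialgebra.toDual k _).injective
        (LinearMap.ext (P.bosonizationForm_mul_left s t)))
    (AlgHom.ext P.bosonizationForm_one_right)
    (AlgHom.ext fun z => DualBialgebra.ext_ev fun s t => by
      refine Eq.trans ?_ ((P.bosonizationForm_mul_right z s t).symm.trans
        (DualBialgebra.ev_comul _ s t).symm)
      simp only [AlgHom.comp_apply, Bialgebra.comulAlgHom_apply]
      induction Coalgebra.comul (R := k) z with
      | zero => simp
      | add a b ha hb => simp only [map_add, LinearMap.add_apply, ha, hb]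
      | tmul a b => rfl)

/-- With one side finite-dimensional, injectivity in both variables forces equal dimensions, so the
pairing is perfect. -/
theorem toDualBialgebra_bijective (hl : Function.Injective β) (hr : Function.Injective β.flip)
    (hPl : Function.Injective P.form) (hPr : Function.Injective P.form.flip) :
    Function.Bijective P.toDualBialgebra := by
  have h : P.bosonizationForm.IsPerfPair := by
    refine .of_injective' (P.bosonizationForm_injective hl hPl) ?_
    rw [← bosonizationForm_flip]
    exact P.flip.bosonizationForm_injective hr hPr
  exact (DualBialgebra.toDual k _).symm.bijective.comp h.bijective_left

end BraidedPairing
end BosonizationPairing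

/-! ### Dual bases and the module over the character group -/

section DualBasis
variable {k Γ : Type*} [Field k] [CommGroup Γ] [Fintype Γ] {ι : Type*} [Fintype ι] [DecidableEq ι]

theorem YetterDrinfeld.proj_of_mem_isotypic {V : Type*} [AddCommGroup V] [Module k V]
    [YetterDrinfeld k Γ V] [DecidableEq Γ] {g : Γ} {χ : Γ →* kˣ} {v : V}
    (hv : v ∈ isotypic k g χ) (h : Γ) : proj k h v = if h = g then v else 0 := by
  split_ifs with e
  · rw [e]; exact hv.1
  · rw [← hv.1, proj_proj_of_ne _ _ _ e]

variable (k) in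
open Classical in
/-- The Yetter-Drinfeld module over the character group with basis elements of prescribed degrees
and weights. -/
@[reducible] def characterYetterDrinfeld (g : ι → Γ) (χ : ι → (Γ →* kˣ)) :
    YetterDrinfeld k (Γ →* kˣ) (ι → k) where
  act :=
    { toFun γ := LinearMap.pi fun i => (γ (g i) : k) • LinearMap.proj i
      map_one' := by ext; simp
      map_mul' γ γ' := by ext; simp [mul_assoc] }
  proj ψ := LinearMap.pi fun i => if ψ = χ i then LinearMap.proj i else 0
  proj_proj_of_ne ψ ψ' f h := by
    ext i
    by_cases h1 : ψ = χ i
    · have h2 : ψ' ≠ χ i := fun e => h (h1.trans e.symm)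
      simp [h1, h2]
    · simp [h1]
  sum_proj f := by
    ext i
    rw [Finset.sum_apply, Finset.sum_eq_single (χ i)]
    · simp
    · intro ψ _ h; simp [h]
    · simp
  proj_act ψ γ f := by
    ext i
    by_cases h : ψ = χ i <;> simp [h]

theorem single_mem_isotypic (g : ι → Γ) (χ : ι → (Γ →* kˣ)) (i : ι) :
    letI := characterYetterDrinfeld k g χ
    Pi.basisFun k ι i ∈ isotypic k (V := ι → k) (χ i) (MonoidHom.eval (g i)) := by
  let := characterYetterDrinfeld k g χ
  refine ⟨funext fun j => ?_, fun γ => funext fun j => ?_⟩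
  · by_cases h : j = i
    · subst h; simp [proj]
    · by_cases h' : χ i = χ j <;> simp [proj, h, h']
  · by_cases h : j = i
    · subst h; simp [act]
    · simp [act, h]

variable {G' W V : Type*} [CommGroup G'] [Fintype G'] [AddCommGroup W] [Module k W]
  [YetterDrinfeld k G' W] [AddCommGroup V] [Module k V] [YetterDrinfeld k Γ V]
  {β : G' →* Γ →* kˣ} {g : ι → Γ} {χ : ι → G'}

/-- The bilinear form for which two given bases are dual to each other. -/
def dualBasesForm (w : Module.Basis ι k W) (v : Module.Basis ι k V) : W →ₗ[k] V →ₗ[k] k :=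
  w.constr k v.coord

theorem dualBasesForm_apply (w : Module.Basis ι k W) (v : Module.Basis ι k V) (i j : ι) :
    dualBasesForm w v (w i) (v j) = if i = j then 1 else 0 := by
  simp [dualBasesForm, Finsupp.single_apply, eq_comm]

theorem dualBasesForm_flip (w : Module.Basis ι k W) (v : Module.Basis ι k V) :
    (dualBasesForm w v).flip = dualBasesForm v w :=
  v.ext fun j => w.ext fun i => by
    rw [LinearMap.flip_apply, dualBasesForm_apply, dualBasesForm_apply]; simp only [eq_comm]

theorem dualBasesForm_separating (w : Module.Basis ι k W) (v : Module.Basis ι k V) {x : W}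
    (h : ∀ y, dualBasesForm w v x y = 0) : x = 0 := by
  refine w.repr.injective (Finsupp.ext fun j => ?_)
  have h' : dualBasesForm w v x (v j) = w.repr x j := by
    rw [← LinearMap.flip_apply, dualBasesForm_flip]
    simp [dualBasesForm]
  rw [← h', h]; simp

/-- On the pair `(w i, v j)` the two sides are `β(γ, g i)` and `β(γ, g j)` times the Kronecker
delta, hence equal. This is where the weight of `w i` being given by the degree of `v i` is used. -/
theorem dualBasesForm_act_left {w : Module.Basis ι k W} {v : Module.Basis ι k V}
    (hw : ∀ i, w i ∈ isotypic k (χ i) (β.flip (g i)))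
    (hv : ∀ i, v i ∈ isotypic k (g i) (β (χ i))) (γ : G') (x : W) (y : V) :
    dualBasesForm w v (act k γ x) y = ∑ h, (β γ h : k) * dualBasesForm w v x (proj k h y) := by
  classical
  suffices h : dualBasesForm w v ∘ₗ act k γ =
      ∑ h : Γ, (β γ h : k) • (dualBasesForm w v).compl₂ (proj k h) by
    simpa [LinearMap.sum_apply] using DFunLike.congr_fun (DFunLike.congr_fun h x) y
  refine w.ext fun i => v.ext fun j => ?_
  rw [LinearMap.comp_apply, (hw i).2]
  simp only [LinearMap.sum_apply, LinearMap.smul_apply, LinearMap.compl₂_apply,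
    proj_of_mem_isotypic (hv j), map_smul]
  rw [Finset.sum_eq_single (g j)]
  · rw [if_pos rfl, dualBasesForm_apply]
    by_cases e : i = j
    · subst e; rfl
    · simp [e]
  · intro h _ hh; simp [hh]
  · simp

theorem dualBasesForm_act_right {w : Module.Basis ι k W} {v : Module.Basis ι k V}
    (hw : ∀ i, w i ∈ isotypic k (χ i) (β.flip (g i)))
    (hv : ∀ i, v i ∈ isotypic k (g i) (β (χ i))) (h : Γ) (x : W) (y : V) :
    dualBasesForm w v x (act k h y) =
      ∑ ψ, (β ψ h : k) * dualBasesForm w v (proj k ψ x) y := by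
  have := dualBasesForm_act_left (β := β.flip) hv hw h y x
  simpa only [← dualBasesForm_flip w v, LinearMap.flip_apply, MonoidHom.flip_apply] using this

end DualBasis

/-- Characters separate the points of `Γ`, because `k` contains enough roots of unity: it is
algebraically closed and the exponent of `Γ` is nonzero in it. -/
theorem evaluation_injective {k Γ : Type*} [Field k] [IsAlgClosed k] [CharZero k] [CommGroup Γ]
    [Finite Γ] : Function.Injective (MonoidHom.id (Γ →* kˣ)).flip := fun g h e => by
  have : NeZero (Monoid.exponent Γ : k) := ⟨by exact_mod_cast Monoid.exponent_ne_zero_of_finite⟩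
  exact (CommGroup.forall_apply_eq_apply_iff Γ (M := k)).mp fun φ => DFunLike.congr_fun e φ

end

theorem corollary2p3 {k : Type u} [Field k] [IsAlgClosed k] [CharZero k]
    {Γ : Type v} [CommGroup Γ] [Fintype Γ]
    {V : Type w} [AddCommGroup V] [Module k V] [YetterDrinfeld k Γ V]
    {t : ℕ} (g : Fin t → Γ) (χ : Fin t → (Γ →* kˣ)) (v : Module.Basis (Fin t) k V)
    (hv : ∀ i, v i ∈ YetterDrinfeld.isotypic k (g i) (χ i))
    [FiniteDimensional k (NicholsAlgebra k Γ V)] :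
    (∃ (W : Type u) (_ : AddCommGroup W) (_ : Module k W) (_ : YetterDrinfeld k (Γ →* kˣ) W)
      (w : Module.Basis (Fin t) k W),
      ∀ i, w i ∈ YetterDrinfeld.isotypic k (χ i) (MonoidHom.eval (g i))) ∧
    ∀ (W : Type x) [AddCommGroup W] [Module k W] [YetterDrinfeld k (Γ →* kˣ) W]
      (w : Module.Basis (Fin t) k W),
      (∀ i, w i ∈ YetterDrinfeld.isotypic k (χ i) (MonoidHom.eval (g i))) →
      Nonempty (DualBialgebra k (Bosonization k Γ (NicholsAlgebra k Γ V)) ≃ₐc[k]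
        Bosonization k (Γ →* kˣ) (NicholsAlgebra k (Γ →* kˣ) W)) := by
  refine ⟨⟨Fin t → k, inferInstance, inferInstance, characterYetterDrinfeld k g χ,
    Pi.basisFun k (Fin t), single_mem_isotypic g χ⟩, fun W _ _ _ w hw => ?_⟩
  -- The bicharacter is evaluation `(γ, h) ↦ γ h`, which as a map on the character group is the
  -- identity; its flip sends `h` to evaluation at `h`.
  let P := BraidedPairing.ofTensorAlgebra (β := MonoidHom.id (Γ →* kˣ)) (dualBasesForm w v)
    (dualBasesForm_act_left (β := MonoidHom.id (Γ →* kˣ)) hw hv)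
    (dualBasesForm_act_right (β := MonoidHom.id (Γ →* kˣ)) hw hv)
  have hP : ∀ x y, P.form (TensorAlgebra.ι k x) (TensorAlgebra.ι k y) = dualBasesForm w v x y :=
    BraidedPairing.ofTensorAlgebra_ι_ι _ _ _
  have hid : Function.Injective (MonoidHom.id (Γ →* kˣ)) := fun _ _ h => h
  have hl := P.nicholsIdeal_eq_leftRadical hid fun x hx =>
    dualBasesForm_separating w v fun y => (hP x y).symm.trans (hx y)
  -- The right radical is the left radical of the flipped pairing, for which the required
  -- injectivity is that characters separate points.
  have hr := P.flip.nicholsIdeal_eq_leftRadical evaluation_injective fun y hy =>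
    dualBasesForm_separating v w fun x => by
      rw [← dualBasesForm_flip, LinearMap.flip_apply, ← hP]
      exact hy x
  -- The pairing gives a map from `𝓑(W) # k[Γ^]` into the dual of `𝓑(V) # k[Γ]`, where `Γ^` is the
  -- character group, so the equivalence has to be inverted.
  exact ⟨(BialgEquiv.ofBijective _ ((P.nichols hl hr).toDualBialgebra_bijective hid
    evaluation_injective (P.nichols_form_injective hl hr)
    (P.nichols_flip_form_injective hl hr))).symm⟩
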